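/- Let $P$ be a (Hausdorff, finite-dimensional, real) smooth manifold with a Poisson bracket $\{\cdot,\cdot\}$ on $C^\infty(P)$, and let $\mathrm{Car}(P)$ be the space of its Casimir functions, i.e. of all $c\in C^\infty(P)$ with $\{c,f\}=0$ for every $f\in C^\infty(P)$. Let $G$ be a finite-dimensional real Lie group with Lie algebra $\mathfrak g$, equipped with the zero Poisson structure, acting smoothly on $P$ from the left by a Poisson action (so every $x\mapsto gx$ preserves the Poisson bracket), and let $\lambda(X)$, $X\in\mathfrak g$, be the infinitesimal action, $(\lambda(X)f)(x)=\frac{d}{dt}\big|_{t=0}f(e^{tX}x)$. Assume that the action is tangential (every $\lambda(X)$ is tangent to the symplectic leaves of $P$) and let $m:P\to\mathfrak g^*$ be a momentum map: a smooth map whose components $m(X)=\langle m(\cdot),X\rangle$ satisfy $\lambda(X)f=\{f,m(X)\}$ for all $X\in\mathfrak g$ and $f\in C^\infty(P)$. Put $\mathrm{Ad}^*_g\xi=\xi\circ\mathrm{Ad}_{g^{-1}}$ for $\xi\in\mathfrak g^*$ and $\Sigma(g,x)=m(gx)-\mathrm{Ad}^*_g m(x)\in\mathfrak g^*$; a momentum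 map $m'$ is called coadjoint-equivariant if $m'(gx)=\mathrm{Ad}^*_g m'(x)$ for all $g\in G$, $x\in P$. Then: 1. For $X,Y\in\mathfrak g$ the function $\Gamma_{X,Y}(x)=\langle d_e\Sigma(\cdot,x)(X),Y\rangle$ equals $m([X,Y])-\{m(X),m(Y)\}$ and is a Casimir function, and $\Gamma$ is a $2$-cocycle of $\mathfrak g$ with values in the trivial $\mathfrak g$-module $\mathrm{Car}(P)$. 2. Suppose that $G$ is connected. Then $\Psi(g)(Y)=\langle\Sigma(g,\cdot),Y\rangle$ is a Casimir function for all $g\in G$, $Y\in\mathfrak g$, and $\Psi$ is a $1$-cocycle of $G$ with values in the space $L(\mathfrak g,\mathrm{Car}(P))\cong\mathfrak g^*\otimes\mathrm{Car}(P)$ of linear maps, on which $G$ acts by $(g\cdot c)(Y)=c(\mathrm{Ad}_{g^{-1}}Y)$; that is, $\Psi(gh)=\Psi(g)+g\cdot\Psi(h)$. The action admits a coadjoint-equivariant momentum map if and only if $\Psi$ is cohomologous to zero, i.e. there is $c\in L(\mathfrak g,\mathrm{Car}(P))$ with $\Psi(g)=g\cdot c-c$ for all $g\in G$. 3. If $G$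 is compact, then the action admits a coadjoint-equivariant momentum map. 4. If $H^1(\mathfrak g,\mathrm{Car}(P))=0$ and $H^2(\mathfrak g,\mathrm{Car}(P))=0$ (Lie algebra cohomology with coefficients in the trivial module $\mathrm{Car}(P)$), then the action admits a coadjoint-equivariant momentum map. In particular, if $\mathfrak g$ is semisimple, then both cohomology spaces vanish and the action admits a coadjoint-equivariant momentum map. -/

import Mathlib

open scoped Manifold ContDiff

noncomputable section

namespace TangentialPoisson

/-! ### Poisson manifolds -/

section Poisson

variable (F : Type*) [NormedAddCommGroup F] [NormedSpace ℝ F]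
  (P : Type*) [TopologicalSpace P] [ChartedSpace F P]

/-- The algebra of smooth real functions on the manifold `P`. -/
abbrev Smooth : Type _ := C^∞⟮𝓘(ℝ, F), P; 𝓘(ℝ, ℝ), ℝ⟯

/-- A Poisson structure on `P`: the structure of a Poisson algebra on `C^∞(P)`. -/
structure PoissonStructure where
  /-- the Poisson bracket `{f, h}` -/
  bracket : Smooth F P →ₗ[ℝ] Smooth F P →ₗ[ℝ] Smooth F P
  alternating : ∀ f, bracket f f = 0
  jacobi : ∀ f h k,
    bracket f (bracket h k) + bracket h (bracket k f) + bracket k (bracket f h) = 0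
  leibniz : ∀ f h k, bracket (f * h) k = f * bracket h k + bracket f k * h

variable {F P}

/-- `Car(P)`: the space of Casimir functions, i.e. of smooth functions that Poisson commute with
all smooth functions. -/
def Casimir (π : PoissonStructure F P) : Submodule ℝ (Smooth F P) where
  carrier := {c | ∀ f, π.bracket c f = 0}
  add_mem' {a b} ha hb f := by simp [ha f, hb f]
  zero_mem' f := by simp
  smul_mem' t c hc f := by simp [hc f]

end Poisson

/-! ### The Lie group, its adjoint representation and the coadjoint module -/

section LieGroup

/-- A smooth Lie group is regular enough for Mathlib's Lie algebra of a Lie group. -/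
instance instLieGroupMinSmoothness {E : Type*} [NormedAddCommGroup E] [NormedSpace ℝ E]
    {G : Type*} [TopologicalSpace G] [ChartedSpace E G] [Group G] [LieGroup 𝓘(ℝ, E) ∞ G] :
    LieGroup 𝓘(ℝ, E) (minSmoothness ℝ 3) G :=
  LieGroup.of_le (n := ∞) (by
    rw [minSmoothness_of_isRCLikeNormedField]; exact ENat.LEInfty.out)

/-- The adjoint action `Ad_g`: the differential at `1` of the conjugation `h ↦ g h g⁻¹`.
(That differential takes values in the tangent space at `g * 1 * g⁻¹`, which is the point `1`.) -/
def Ad (E : Type*) [NormedAddCommGroup E] [NormedSpace ℝ E] {G : Type*} [TopologicalSpace G]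
    [ChartedSpace E G] [Group G] (g : G) :
    GroupLieAlgebra 𝓘(ℝ, E) G →ₗ[ℝ] GroupLieAlgebra 𝓘(ℝ, E) G where
  toFun X := mfderiv 𝓘(ℝ, E) 𝓘(ℝ, E) (fun h : G ↦ g * h * g⁻¹) 1 X
  map_add' X Y := map_add (mfderiv 𝓘(ℝ, E) 𝓘(ℝ, E) (fun h : G ↦ g * h * g⁻¹) 1) X Y
  map_smul' t X := map_smul (mfderiv 𝓘(ℝ, E) 𝓘(ℝ, E) (fun h : G ↦ g * h * g⁻¹) 1) t X

variable {E : Type*} [NormedAddCommGroup E] [NormedSpace ℝ E]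
  {G : Type*} [TopologicalSpace G] [ChartedSpace E G] [Group G]

theorem Ad_one : Ad E (1 : G) = LinearMap.id := by
  ext X
  have h : (fun h : G ↦ 1 * h * 1⁻¹) = id := by ext h; simp
  change mfderiv 𝓘(ℝ, E) 𝓘(ℝ, E) (fun h : G ↦ 1 * h * 1⁻¹) 1 X = X
  rw [h, mfderiv_id]
  rfl

theorem Ad_mul [LieGroup 𝓘(ℝ, E) ∞ G] (g h : G) : Ad E (g * h) = Ad E g ∘ₗ Ad E h := by
  have hs : ∀ a : G, MDifferentiable 𝓘(ℝ, E) 𝓘(ℝ, E) (fun k : G ↦ a * k * a⁻¹) := fun a ↦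
    ((contMDiff_mul_right (I := 𝓘(ℝ, E)) (n := ∞) (a := a⁻¹)).comp
      (contMDiff_mul_left (I := 𝓘(ℝ, E)) (n := ∞) (a := a))).mdifferentiable (by simp)
  ext X
  have hc : (fun k : G ↦ g * h * k * (g * h)⁻¹) =
      (fun k : G ↦ g * k * g⁻¹) ∘ (fun k : G ↦ h * k * h⁻¹) := by
    ext k; simp [mul_assoc]
  have h1 : h * 1 * h⁻¹ = (1 : G) := by simp
  change mfderiv 𝓘(ℝ, E) 𝓘(ℝ, E) (fun k : G ↦ g * h * k * (g * h)⁻¹) 1 X =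
    mfderiv 𝓘(ℝ, E) 𝓘(ℝ, E) (fun k : G ↦ g * k * g⁻¹) 1
      (mfderiv 𝓘(ℝ, E) 𝓘(ℝ, E) (fun k : G ↦ h * k * h⁻¹) 1 X)
  rw [hc, mfderiv_comp (I' := 𝓘(ℝ, E)) 1 (hs g _) (hs h _)]
  have key : ∀ a : G, a = 1 → ∀ v : E,
      (mfderiv 𝓘(ℝ, E) 𝓘(ℝ, E) (fun k : G ↦ g * k * g⁻¹) a v : E) =
      (mfderiv 𝓘(ℝ, E) 𝓘(ℝ, E) (fun k : G ↦ g * k * g⁻¹) 1 v : E) := by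
    rintro a rfl v; rfl
  exact key _ h1 _

/-- For a vector space `V`, the coadjoint representation of `G` on the space `L(𝔤, V)` of linear
maps `𝔤 → V` (that is, on `𝔤* ⊗ V`, with `V` carrying the trivial action):
`(g · c)(Y) = c(Ad_{g⁻¹} Y)`. -/
def coadjointRep (E : Type*) [NormedAddCommGroup E] [NormedSpace ℝ E]
    (G : Type*) [TopologicalSpace G] [ChartedSpace E G] [Group G] [LieGroup 𝓘(ℝ, E) ∞ G]
    (V : Type*) [AddCommGroup V] [Module ℝ V] :
    Representation ℝ G (GroupLieAlgebra 𝓘(ℝ, E) G →ₗ[ℝ] V) where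
  toFun g :=
    { toFun := fun c ↦ c ∘ₗ Ad E g⁻¹
      map_add' := fun _ _ ↦ rfl
      map_smul' := fun _ _ ↦ rfl }
  map_one' := by
    refine LinearMap.ext fun c ↦ ?_
    change c ∘ₗ Ad E (1 : G)⁻¹ = c
    rw [inv_one, Ad_one, LinearMap.comp_id]
  map_mul' g h := by
    refine LinearMap.ext fun c ↦ ?_
    change c ∘ₗ Ad E (g * h)⁻¹ = (c ∘ₗ Ad E h⁻¹) ∘ₗ Ad E g⁻¹
    rw [mul_inv_rev, Ad_mul, LinearMap.comp_assoc]

end LieGroup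

/-! ### Cohomology -/

section Cohomology

/-- `Ψ` is a `1`-cocycle of the group `G` with values in the representation `ρ`. -/
def IsGroupOneCocycle {G V : Type*} [Group G] [AddCommGroup V] [Module ℝ V]
    (ρ : Representation ℝ G V) (Ψ : G → V) : Prop :=
  ∀ g h : G, Ψ (g * h) = Ψ g + ρ g (Ψ h)

/-- `Ψ` is a `1`-coboundary of the group `G` with values in the representation `ρ`. -/
def IsGroupOneCoboundary {G V : Type*} [Group G] [AddCommGroup V] [Module ℝ V]
    (ρ : Representation ℝ G V) (Ψ : G → V) : Prop :=
  ∃ c : V, ∀ g : G, Ψ g = ρ g c - c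

variable (L : Type*) [LieRing L] [LieAlgebra ℝ L]
  (M : Type*) [AddCommGroup M] [Module ℝ M] [LieRingModule L M] [LieModule ℝ L M]

/-- The Chevalley-Eilenberg differential from `0`-cochains to `1`-cochains:
`v ↦ (x ↦ ⁅x, v⁆)`. -/
def lieD₀₁ : M →ₗ[ℝ] LieModule.Cohomology.oneCochain ℝ L M :=
  (LieModule.toEnd ℝ L M : L →ₗ[ℝ] Module.End ℝ M).flip

/-- `H¹(L, M) = 0`: every `1`-cocycle is a `1`-coboundary. -/
def LieH1Vanishes : Prop :=
  LinearMap.ker (LieModule.Cohomology.d₁₂ ℝ L M) ≤ LinearMap.range (lieD₀₁ L M)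

/-- `H²(L, M) = 0`: every `2`-cocycle is a `2`-coboundary. -/
def LieH2Vanishes : Prop :=
  LieModule.Cohomology.twoCocycle ℝ L M ≤ LinearMap.range (LieModule.Cohomology.d₁₂ ℝ L M)

end Cohomology

/-! ### Tangential Poisson actions and momentum maps -/

section Action

variable (E : Type*) [NormedAddCommGroup E] [NormedSpace ℝ E]
  {F : Type*} [NormedAddCommGroup F] [NormedSpace ℝ F]
  (G : Type*) [TopologicalSpace G] [ChartedSpace E G] [Group G]
  {P : Type*} [TopologicalSpace P] [ChartedSpace F P] [MulAction G P]

/-- The function `f ∘ σ_g`, where `σ_g x = g • x`. -/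
def translate {G : Type*} [TopologicalSpace G] [ChartedSpace E G] [Group G] [MulAction G P]
    [ContMDiffSMul 𝓘(ℝ, E) 𝓘(ℝ, F) ∞ G P] (g : G) (f : Smooth F P) : Smooth F P :=
  ⟨fun x ↦ f (g • x), f.contMDiff.comp
    ((contMDiff_smul (I := 𝓘(ℝ, E)) (I' := 𝓘(ℝ, F)) (n := ∞) (G := G) (M := P)).comp
      (contMDiff_const.prodMk contMDiff_id))⟩

/-- The action of `G`, with the zero Poisson structure on `G`, is a Poisson action: every
`σ_g` preserves the Poisson structure of `P`. -/
def IsPoissonAction [ContMDiffSMul 𝓘(ℝ, E) 𝓘(ℝ, F) ∞ G P] (π : PoissonStructure F P) : Prop :=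
  ∀ (g : G) (f h : Smooth F P),
    π.bracket (translate E g f) (translate E g h) = translate E g (π.bracket f h)

variable {E G}

/-- The infinitesimal action `λ(X)`, a vector field on `P`, acting on functions:
`(λ(X) f)(x) = ⟨d(f ∘ σ_x)(1), X⟩` with `σ_x g = g • x`, i.e. the derivative at `t = 0` of
`f (exp (t X) • x)`. -/
def infinitesimalAction (X : GroupLieAlgebra 𝓘(ℝ, E) G) (f : Smooth F P) (x : P) : ℝ :=
  mfderiv 𝓘(ℝ, E) 𝓘(ℝ, ℝ) (fun g : G ↦ f (g • x)) 1 X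

variable (E G) in
/-- The action is tangential: every `λ(X)` is tangent to the symplectic leaves of `P`; the tangent
space of the leaf through `x` consists of the values at `x` of the Hamiltonian vector fields. -/
def IsTangential (π : PoissonStructure F P) : Prop :=
  ∀ (X : GroupLieAlgebra 𝓘(ℝ, E) G) (x : P), ∃ k : Smooth F P,
    ∀ f : Smooth F P, infinitesimalAction X f x = π.bracket k f x

variable (E F G P) in
/-- A smooth map from `P` to the dual `𝔤*` of the Lie algebra of `G`; as `𝔤` is finite
dimensional, smoothness is smoothness of all components. -/
structure SmoothMapToDual where
  /-- the underlying map -/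
  toFun : P → Module.Dual ℝ (GroupLieAlgebra 𝓘(ℝ, E) G)
  smooth : ∀ X : GroupLieAlgebra 𝓘(ℝ, E) G,
    ContMDiff 𝓘(ℝ, F) 𝓘(ℝ, ℝ) ∞ (fun x ↦ toFun x X)

/-- The component `m(X) ∈ C^∞(P)` of `m : P → 𝔤*`. -/
def SmoothMapToDual.component (m : SmoothMapToDual E F G P) (X : GroupLieAlgebra 𝓘(ℝ, E) G) :
    Smooth F P :=
  ⟨fun x ↦ m.toFun x X, m.smooth X⟩

/-- `m : P → 𝔤*` is a momentum map: `λ(X)` is the Hamiltonian vector field `{·, m(X)}`. -/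
def IsMomentumMap (π : PoissonStructure F P) (m : SmoothMapToDual E F G P) : Prop :=
  ∀ (X : GroupLieAlgebra 𝓘(ℝ, E) G) (f : Smooth F P) (x : P),
    infinitesimalAction X f x = π.bracket f (m.component X) x

/-- `Σ(g, x) = m(g x) - Ad*_g m(x) ∈ 𝔤*`, where `⟨Ad*_g ξ, Y⟩ = ⟨ξ, Ad_{g⁻¹} Y⟩`. -/
def SmoothMapToDual.defect (m : SmoothMapToDual E F G P) (g : G) (x : P) :
    Module.Dual ℝ (GroupLieAlgebra 𝓘(ℝ, E) G) :=
  m.toFun (g • x) - m.toFun x ∘ₗ Ad E g⁻¹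

/-- `m` intertwines the action on `P` with the coadjoint action on `𝔤*`. -/
def SmoothMapToDual.IsCoadjointEquivariant (m : SmoothMapToDual E F G P) : Prop :=
  ∀ (g : G) (x : P), m.toFun (g • x) = m.toFun x ∘ₗ Ad E g⁻¹

variable (E G) in
/-- The action of `G` on `P` has a coadjoint-equivariant momentum map. -/
def HasEquivariantMomentumMap (π : PoissonStructure F P) : Prop :=
  ∃ m : SmoothMapToDual E F G P, IsMomentumMap π m ∧ m.IsCoadjointEquivariant

variable (E G) in
/-- `Car(P)` as a trivial module over the Lie algebra of `G`. -/
abbrev TrivialCasimir [CompleteSpace E] [LieGroup 𝓘(ℝ, E) ∞ G] (π : PoissonStructure F P) :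
    Type _ :=
  TrivialLieModule ℝ (GroupLieAlgebra 𝓘(ℝ, E) G) (Casimir π)

end Action

end TangentialPoisson

end

open TangentialPoisson

/-
Differentiating a function of `g ∈ G` along left translations reduces statements about the identity
component to the tangent space at `1`. Thus Casimir functions are constant along the action of that
component, so there the failure of `m` to be equivariant is a cocycle `Ψ`, with derivative the Lie
algebra cocycle `Γ`. Momentum maps differ by linear maps `c : 𝔤 → Car(P)`, and adding `c` changes
`Ψ` and `Γ` by coboundaries.

If `H² = 0`, one can therefore arrange that `Γ = 0`. Then `Ψ(g)` kills all Lie brackets because `g`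
preserves the Poisson bracket, and so it vanishes if `H¹ = 0`.

If `G` is compact, `g ↦ Ad*_g m(g⁻¹ x)` is averaged over Haar measure. As the Poisson bracket is
not assumed to be continuous, an integral of Casimir functions need not obviously be one. But the
functions `Ψ(g)(Y)` span a finite-dimensional space: on the identity component they lie in the
span of the `Γ_{X, Y}`, and there are only finitely many components. So the correction of `m` is an
average inside a finite-dimensional space of Casimir functions.
-/

noncomputable section

namespace TangentialPoisson

open Filter Topology

section MixedPartials

variable {E : Type*} [NormedAddCommGroup E] [NormedSpace ℝ E]
  {E' : Type*} [NormedAddCommGroup E'] [NormedSpace ℝ E']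
  {V : Type*} [NormedAddCommGroup V] [NormedSpace ℝ V]

theorem fderiv_uncurry_apply_right {f : E → E' → V} {u : E} {v : E'}
    (hf : DifferentiableAt ℝ (Function.uncurry f) (u, v)) (Y : E') :
    fderiv ℝ (f u) v Y = fderiv ℝ (Function.uncurry f) (u, v) (0, Y) := by
  have h : HasFDerivAt (f u) _ v := hf.hasFDerivAt.comp v (hasFDerivAt_prodMk_right u v)
  rw [h.fderiv]
  simp

theorem fderiv_uncurry_apply_left {f : E → E' → V} {u : E} {v : E'}
    (hf : DifferentiableAt ℝ (Function.uncurry f) (u, v)) (X : E) :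
    fderiv ℝ (f · v) u X = fderiv ℝ (Function.uncurry f) (u, v) (X, 0) := by
  have h : HasFDerivAt (f · v) _ u := hf.hasFDerivAt.comp (f := (·, v)) u
    (hasFDerivAt_prodMk_left u v)
  rw [h.fderiv]
  simp

theorem fderiv_fderiv_comm {f : E → E' → V} {u₀ : E} {v₀ : E'}
    (hf : ContDiffAt ℝ 2 (Function.uncurry f) (u₀, v₀)) (X : E) (Y : E') :
    fderiv ℝ (fun u ↦ fderiv ℝ (f u) v₀ Y) u₀ X =
      fderiv ℝ (fun v ↦ fderiv ℝ (f · v) u₀ X) v₀ Y := by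
  have hdiff : ∀ᶠ p in 𝓝 (u₀, v₀), DifferentiableAt ℝ (Function.uncurry f) p :=
    (hf.eventually (by simp)).mono fun p hp ↦ hp.differentiableAt (by simp)
  have hdiff' : DifferentiableAt ℝ (fderiv ℝ (Function.uncurry f)) (u₀, v₀) :=
    (hf.fderiv_right (m := 1) (by norm_num)).differentiableAt (by simp)
  have hright : (fun u ↦ fderiv ℝ (f u) v₀ Y) =ᶠ[𝓝 u₀]
      fun u ↦ fderiv ℝ (Function.uncurry f) (u, v₀) (0, Y) :=
    (((Continuous.prodMk_left v₀).tendsto u₀).eventually hdiff).mono fun _ hu ↦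
      fderiv_uncurry_apply_right hu Y
  have hleft : (fun v ↦ fderiv ℝ (f · v) u₀ X) =ᶠ[𝓝 v₀]
      fun v ↦ fderiv ℝ (Function.uncurry f) (u₀, v) (X, 0) :=
    (((Continuous.prodMk_right u₀).tendsto v₀).eventually hdiff).mono fun _ hv ↦
      fderiv_uncurry_apply_left hv X
  have hX : HasFDerivAt (fun u ↦ fderiv ℝ (Function.uncurry f) (u, v₀) (0, Y)) _ u₀ :=
    (hdiff'.hasFDerivAt.comp u₀ (hasFDerivAt_prodMk_left u₀ v₀)).clm_apply
      (hasFDerivAt_const ((0 : E), Y) u₀)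
  have hY : HasFDerivAt (fun v ↦ fderiv ℝ (Function.uncurry f) (u₀, v) (X, 0)) _ v₀ :=
    (hdiff'.hasFDerivAt.comp v₀ (hasFDerivAt_prodMk_right u₀ v₀)).clm_apply
      (hasFDerivAt_const (X, (0 : E')) v₀)
  rw [hright.fderiv_eq, hleft.fderiv_eq, hX.fderiv, hY.fderiv]
  simpa using hf.isSymmSndFDerivAt (by simp) (X, 0) (0, Y)

end MixedPartials

section VectorValued

variable {E : Type*} [NormedAddCommGroup E] [NormedSpace ℝ E]
  {M : Type*} [TopologicalSpace M] [ChartedSpace E M]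
  {E' : Type*} [NormedAddCommGroup E'] [NormedSpace ℝ E']
  {N : Type*} [TopologicalSpace N] [ChartedSpace E' N]
  {V : Type*} [NormedAddCommGroup V] [NormedSpace ℝ V]

theorem mdifferentiableAt_iff_comp_extChartAt_symm {f : M → V} {x : M} :
    MDifferentiableAt 𝓘(ℝ, E) 𝓘(ℝ, V) f x ↔
      DifferentiableAt ℝ (f ∘ (extChartAt 𝓘(ℝ, E) x).symm) (extChartAt 𝓘(ℝ, E) x x) := by
  rw [mdifferentiableAt_iff, ModelWithCorners.range_eq_univ, differentiableWithinAt_univ]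
  refine ⟨fun h ↦ h.2, fun h ↦ ⟨?_, h⟩⟩
  refine (h.continuousAt.comp (continuousAt_extChartAt (I := 𝓘(ℝ, E)) x)).congr ?_
  filter_upwards [extChartAt_source_mem_nhds (I := 𝓘(ℝ, E)) x] with y hy
  simp only [Function.comp_apply, (extChartAt 𝓘(ℝ, E) x).left_inv hy]

theorem mvfderiv_eq_fderiv_comp_extChartAt_symm (f : M → V) (x : M) :
    mvfderiv 𝓘(ℝ, E) f x =
      fderiv ℝ (f ∘ (extChartAt 𝓘(ℝ, E) x).symm) (extChartAt 𝓘(ℝ, E) x x) := by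
  by_cases hf : MDifferentiableAt 𝓘(ℝ, E) 𝓘(ℝ, V) f x
  · rw [hf.mvfderiv, ModelWithCorners.range_eq_univ, fderivWithin_univ]
    rfl
  · rw [mvfderiv, mfderiv_zero_of_not_mdifferentiableAt hf,
      fderiv_zero_of_not_differentiableAt (mt mdifferentiableAt_iff_comp_extChartAt_symm.2 hf)]
    rfl

theorem mvfderiv_congr {f f' : M → V} {x : M} (h : f =ᶠ[𝓝 x] f') :
    mvfderiv 𝓘(ℝ, E) f x = mvfderiv 𝓘(ℝ, E) f' x := by
  rw [mvfderiv, mvfderiv, h.mfderiv_eq]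
  rfl

theorem contDiffAt_uncurry_comp_extChartAt_symm {n : WithTop ℕ∞} [IsManifold 𝓘(ℝ, E) n M]
    [IsManifold 𝓘(ℝ, E') n N] {f : M → N → V} {x : M} {y : N}
    (hf : ContMDiffAt (𝓘(ℝ, E).prod 𝓘(ℝ, E')) 𝓘(ℝ, V) n (Function.uncurry f) (x, y)) :
    ContDiffAt ℝ n (Function.uncurry fun u v ↦
        f ((extChartAt 𝓘(ℝ, E) x).symm u) ((extChartAt 𝓘(ℝ, E') y).symm v))
      (extChartAt 𝓘(ℝ, E) x x, extChartAt 𝓘(ℝ, E') y y) := by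
  have hx := (contMDiffOn_extChartAt_symm (I := 𝓘(ℝ, E)) (n := n) x).contMDiffAt
    (extChartAt_target_mem_nhds x)
  have hy := (contMDiffOn_extChartAt_symm (I := 𝓘(ℝ, E')) (n := n) y).contMDiffAt
    (extChartAt_target_mem_nhds y)
  rw [← contMDiffAt_iff_contDiffAt, modelWithCornersSelf_prod, ← chartedSpaceSelf_prod]
  refine ContMDiffAt.comp (I' := 𝓘(ℝ, E).prod 𝓘(ℝ, E')) (g := Function.uncurry f) _ ?_
    (hx.prodMap hy)
  simpa only [Prod.map_apply, extChartAt_to_inv] using hf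

theorem mvfderiv_mvfderiv_comm [IsManifold 𝓘(ℝ, E) 2 M] [IsManifold 𝓘(ℝ, E') 2 N]
    {f : M → N → V} {x : M} {y : N}
    (hf : ContMDiffAt (𝓘(ℝ, E).prod 𝓘(ℝ, E')) 𝓘(ℝ, V) 2 (Function.uncurry f) (x, y))
    (X : TangentSpace 𝓘(ℝ, E) x) (Y : TangentSpace 𝓘(ℝ, E') y) :
    mvfderiv 𝓘(ℝ, E) (fun z ↦ mvfderiv 𝓘(ℝ, E') (f z) y Y) x X =
      mvfderiv 𝓘(ℝ, E') (fun w ↦ mvfderiv 𝓘(ℝ, E) (f · w) x X) y Y := by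
  simp only [mvfderiv_eq_fderiv_comp_extChartAt_symm]
  exact fderiv_fderiv_comm (contDiffAt_uncurry_comp_extChartAt_symm hf) X Y

theorem mdifferentiableAt_mvfderiv_right [IsManifold 𝓘(ℝ, E) 2 M] [IsManifold 𝓘(ℝ, E') 2 N]
    {f : M → N → V} {x : M} {y : N}
    (hf : ContMDiffAt (𝓘(ℝ, E).prod 𝓘(ℝ, E')) 𝓘(ℝ, V) 2 (Function.uncurry f) (x, y)) :
    MDifferentiableAt 𝓘(ℝ, E) 𝓘(ℝ, E' →L[ℝ] V) (M' := E' →L[ℝ] V)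
      (fun z ↦ mvfderiv 𝓘(ℝ, E') (f z) y) x := by
  simp only [mvfderiv_eq_fderiv_comp_extChartAt_symm]
  exact mdifferentiableAt_iff_comp_extChartAt_symm.2 <|
    ((contDiffAt_uncurry_comp_extChartAt_symm hf).fderiv (m := 1) contDiffAt_const
      (by norm_num)).differentiableAt (by simp)

end VectorValued

section Bracket

open VectorField

variable {E : Type*} [NormedAddCommGroup E] [NormedSpace ℝ E]
  {M : Type*} [TopologicalSpace M] [ChartedSpace E M]
  {V : Type*} [NormedAddCommGroup V] [NormedSpace ℝ V]

/-- The expression of the vector field `X` in the preferred chart at `x`; only its values on the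
target of the chart are meaningful. -/
def fieldInChart (X : ∀ y : M, TangentSpace 𝓘(ℝ, E) y) (x : M) : E → E :=
  mpullbackWithin 𝓘(ℝ, E) 𝓘(ℝ, E) (extChartAt 𝓘(ℝ, E) x).symm X (Set.range 𝓘(ℝ, E))

theorem fderiv_comp_extChartAt_symm_fieldInChart [IsManifold 𝓘(ℝ, E) 1 M] {f : M → V} {x : M}
    {u : E} (hu : u ∈ (extChartAt 𝓘(ℝ, E) x).target)
    (hf : MDifferentiableAt 𝓘(ℝ, E) 𝓘(ℝ, V) f ((extChartAt 𝓘(ℝ, E) x).symm u))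
    (X : ∀ y : M, TangentSpace 𝓘(ℝ, E) y) :
    fderiv ℝ (f ∘ (extChartAt 𝓘(ℝ, E) x).symm) u (fieldInChart X x u) =
      mvfderiv 𝓘(ℝ, E) f ((extChartAt 𝓘(ℝ, E) x).symm u)
        (X ((extChartAt 𝓘(ℝ, E) x).symm u)) := by
  have hinv := isInvertible_mfderivWithin_extChartAt_symm hu
  have hsymm := mdifferentiableWithinAt_extChartAt_symm hu
  rw [fieldInChart, mpullbackWithin_apply]
  simp only [ModelWithCorners.range_eq_univ, mfderivWithin_univ,
    mdifferentiableWithinAt_univ] at hinv hsymm ⊢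
  have hcomp := mfderiv_comp u hf hsymm
  rw [mfderiv_eq_fderiv] at hcomp
  rw [hcomp]
  exact congrArg (mvfderiv 𝓘(ℝ, E) f ((extChartAt 𝓘(ℝ, E) x).symm u))
    (hinv.self_apply_inverse _)

theorem mvfderiv_mvfderiv_apply_eq_fderiv [IsManifold 𝓘(ℝ, E) 1 M] {f : M → V} {x : M}
    (hf : ∀ᶠ y in 𝓝 x, MDifferentiableAt 𝓘(ℝ, E) 𝓘(ℝ, V) f y)
    (X : ∀ y : M, TangentSpace 𝓘(ℝ, E) y) :
    mvfderiv 𝓘(ℝ, E) (fun y ↦ mvfderiv 𝓘(ℝ, E) f y (X y)) x =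
      fderiv ℝ (fun u ↦ fderiv ℝ (f ∘ (extChartAt 𝓘(ℝ, E) x).symm) u (fieldInChart X x u))
        (extChartAt 𝓘(ℝ, E) x x) := by
  have hsymm : Tendsto (extChartAt 𝓘(ℝ, E) x).symm (𝓝 (extChartAt 𝓘(ℝ, E) x x)) (𝓝 x) := by
    simpa only [ContinuousAt, extChartAt_to_inv] using
      continuousAt_extChartAt_symm (I := 𝓘(ℝ, E)) x
  rw [mvfderiv_eq_fderiv_comp_extChartAt_symm]
  refine EventuallyEq.fderiv_eq ?_
  filter_upwards [hsymm.eventually hf, extChartAt_target_mem_nhds (I := 𝓘(ℝ, E)) x] with u hfu hu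
  exact (fderiv_comp_extChartAt_symm_fieldInChart hu hfu X).symm

theorem differentiableAt_fieldInChart [CompleteSpace E] [IsManifold 𝓘(ℝ, E) 2 M] {x : M}
    {X : ∀ y : M, TangentSpace 𝓘(ℝ, E) y}
    (hX : MDifferentiableAt 𝓘(ℝ, E) 𝓘(ℝ, E).tangent
      (fun y ↦ (X y : TangentBundle 𝓘(ℝ, E) M)) x) :
    DifferentiableAt ℝ (fieldInChart X x) (extChartAt 𝓘(ℝ, E) x x) := by
  have h : DifferentiableWithinAt ℝ (fieldInChart X x) _ (extChartAt 𝓘(ℝ, E) x x) :=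
    (mdifferentiableWithinAt_univ.2 hX).differentiableWithinAt_mpullbackWithin_vectorField
  rwa [Set.preimage_univ, Set.univ_inter, ModelWithCorners.range_eq_univ,
    differentiableWithinAt_univ] at h

theorem fieldInChart_self [IsManifold 𝓘(ℝ, E) 1 M] (X : ∀ y : M, TangentSpace 𝓘(ℝ, E) y) (x : M) :
    fieldInChart X x (extChartAt 𝓘(ℝ, E) x x) = X x := by
  rw [fieldInChart, mpullbackWithin_apply, extChartAt_to_inv]
  exact mfderivWithin_extChartAt_symm_inverse_apply (X x)

theorem mlieBracket_eq_lieBracket_fieldInChart [IsManifold 𝓘(ℝ, E) 1 M]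
    (X Y : ∀ y : M, TangentSpace 𝓘(ℝ, E) y) (x : M) :
    mlieBracket 𝓘(ℝ, E) X Y x =
      lieBracket ℝ (fieldInChart X x) (fieldInChart Y x) (extChartAt 𝓘(ℝ, E) x x) := by
  rw [← mlieBracketWithin_univ, mlieBracketWithin_apply, mfderiv_extChartAt_self,
    Set.preimage_univ, Set.univ_inter]
  refine (congrArg (fun T : E →L[ℝ] E ↦ T _) ContinuousLinearMap.inverse_id).trans ?_
  change lieBracketWithin ℝ (fieldInChart X x) (fieldInChart Y x) (Set.range 𝓘(ℝ, E)) _ = _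
  rw [ModelWithCorners.range_eq_univ, lieBracketWithin_univ]

theorem mvfderiv_mlieBracket [CompleteSpace E] [IsManifold 𝓘(ℝ, E) 2 M] {f : M → V} {x : M}
    {X Y : ∀ y : M, TangentSpace 𝓘(ℝ, E) y} (hf : ContMDiffAt 𝓘(ℝ, E) 𝓘(ℝ, V) 2 f x)
    (hX : MDifferentiableAt 𝓘(ℝ, E) 𝓘(ℝ, E).tangent
      (fun y ↦ (X y : TangentBundle 𝓘(ℝ, E) M)) x)
    (hY : MDifferentiableAt 𝓘(ℝ, E) 𝓘(ℝ, E).tangent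
      (fun y ↦ (Y y : TangentBundle 𝓘(ℝ, E) M)) x) :
    mvfderiv 𝓘(ℝ, E) f x (mlieBracket 𝓘(ℝ, E) X Y x) =
      mvfderiv 𝓘(ℝ, E) (fun y ↦ mvfderiv 𝓘(ℝ, E) f y (Y y)) x (X x) -
        mvfderiv 𝓘(ℝ, E) (fun y ↦ mvfderiv 𝓘(ℝ, E) f y (X y)) x (Y x) := by
  have : IsManifold 𝓘(ℝ, E) 1 M := .of_le (n := 2) (by norm_num)
  have hdiff : ∀ᶠ y in 𝓝 x, MDifferentiableAt 𝓘(ℝ, E) 𝓘(ℝ, V) f y :=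
    (contMDiffAt_iff_contMDiffAt_nhds (by simp) |>.1 hf).mono fun y hy ↦
      hy.mdifferentiableAt (by simp)
  have hchart : ContDiffAt ℝ 2 (f ∘ (extChartAt 𝓘(ℝ, E) x).symm) (extChartAt 𝓘(ℝ, E) x x) := by
    simpa only [ModelWithCorners.range_eq_univ, contDiffWithinAt_univ, extChartAt_model_space_eq_id,
      PartialEquiv.refl_coe, Function.id_comp] using (contMDiffAt_iff.1 hf).2
  have h := fderiv_apply_lieBracket_of_isSymmSndFDerivAt hchart
    (hchart.isSymmSndFDerivAt (by simp)) (differentiableAt_fieldInChart hY)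
    (differentiableAt_fieldInChart hX)
  rw [fieldInChart_self, fieldInChart_self] at h
  rw [mvfderiv_mvfderiv_apply_eq_fderiv hdiff, mvfderiv_mvfderiv_apply_eq_fderiv hdiff,
    mvfderiv_eq_fderiv_comp_extChartAt_symm, mlieBracket_eq_lieBracket_fieldInChart]
  exact h

end Bracket

section LocallyConstant

variable {E : Type*} [NormedAddCommGroup E] [NormedSpace ℝ E]
  {M : Type*} [TopologicalSpace M] [ChartedSpace E M] [IsManifold 𝓘(ℝ, E) 1 M]
  {V : Type*} [NormedAddCommGroup V] [NormedSpace ℝ V] {f : M → V} {s : Set M}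

theorem eventually_eq_of_hasMFDerivAt_zero (hs : IsOpen s)
    (hf : ∀ x ∈ s, HasMFDerivAt 𝓘(ℝ, E) 𝓘(ℝ, V) f x 0) {x : M} (hx : x ∈ s) :
    ∀ᶠ y in 𝓝 x, f y = f x := by
  set φ := extChartAt 𝓘(ℝ, E) x
  have hderiv (u : E) (hu : u ∈ φ.target) (hus : φ.symm u ∈ s) :
      HasFDerivAt (f ∘ φ.symm) (0 : E →L[ℝ] V) u := by
    have hsymm := mdifferentiableWithinAt_extChartAt_symm hu
    rw [ModelWithCorners.range_eq_univ, mdifferentiableWithinAt_univ] at hsymm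
    have hcomp := (hf _ hus).comp u hsymm.hasMFDerivAt
    rw [ContinuousLinearMap.zero_comp] at hcomp
    exact hcomp.hasFDerivAt
  have hsymm_s : φ.symm ⁻¹' s ∈ 𝓝 (φ x) :=
    (continuousAt_extChartAt_symm x).preimage_mem_nhds <| by
      rw [extChartAt_to_inv]
      exact hs.mem_nhds hx
  obtain ⟨r, hr, hball⟩ :=
    Metric.mem_nhds_iff.1 (inter_mem (extChartAt_target_mem_nhds (I := 𝓘(ℝ, E)) x) hsymm_s)
  have hconst (u : E) (hu : u ∈ Metric.ball (φ x) r) : f (φ.symm u) = f (φ.symm (φ x)) :=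
    Metric.isOpen_ball.is_const_of_fderiv_eq_zero (convex_ball (φ x) r).isPreconnected
      (fun v hv ↦ (hderiv v (hball hv).1 (hball hv).2).differentiableAt.differentiableWithinAt)
      (fun v hv ↦ (hderiv v (hball hv).1 (hball hv).2).fderiv) hu (Metric.mem_ball_self hr)
  filter_upwards [(continuousAt_extChartAt x).preimage_mem_nhds (Metric.ball_mem_nhds (φ x) hr),
    extChartAt_source_mem_nhds (I := 𝓘(ℝ, E)) x] with y hy hys
  have hy' := hconst _ hy
  rwa [φ.left_inv hys, extChartAt_to_inv] at hy'

theorem eq_of_hasMFDerivAt_zero (hs : IsOpen s) (hs' : IsPreconnected s)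
    (hf : ∀ x ∈ s, HasMFDerivAt 𝓘(ℝ, E) 𝓘(ℝ, V) f x 0) {x y : M} (hx : x ∈ s) (hy : y ∈ s) :
    f x = f y := by
  have : PreconnectedSpace s := isPreconnected_iff_preconnectedSpace.1 hs'
  have hlocal : IsLocallyConstant (s.domRestrict f) := by
    rw [IsLocallyConstant.iff_eventually_eq]
    exact fun z ↦ continuous_subtype_val.continuousAt.eventually
      (eventually_eq_of_hasMFDerivAt_zero hs hf z.2)
  exact hlocal.apply_eq_of_preconnectedSpace ⟨x, hx⟩ ⟨y, hy⟩

end LocallyConstant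

section ClmApply

variable {E : Type*} [NormedAddCommGroup E] [NormedSpace ℝ E]
  {M : Type*} [TopologicalSpace M] [ChartedSpace E M]
  {V : Type*} [NormedAddCommGroup V] [NormedSpace ℝ V]
  {W : Type*} [NormedAddCommGroup W] [NormedSpace ℝ W]

theorem mvfderiv_clm_apply {L : M → V →L[ℝ] W} {a : M → V} {x : M}
    (hL : MDifferentiableAt 𝓘(ℝ, E) 𝓘(ℝ, V →L[ℝ] W) L x)
    (ha : MDifferentiableAt 𝓘(ℝ, E) 𝓘(ℝ, V) a x) (X : TangentSpace 𝓘(ℝ, E) x) :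
    mvfderiv 𝓘(ℝ, E) (fun y ↦ L y (a y)) x X =
      L x (mvfderiv 𝓘(ℝ, E) a x X) + mvfderiv 𝓘(ℝ, E) (fun y ↦ L y (a x)) x X := by
  have hL' := (mdifferentiableAt_iff_comp_extChartAt_symm.1 hL).hasFDerivAt
  have ha' := (mdifferentiableAt_iff_comp_extChartAt_symm.1 ha).hasFDerivAt
  have hla := (hL'.clm_apply ha').fderiv
  have hlx := (hL'.clm_apply (hasFDerivAt_const (a x) _)).fderiv
  simp only [Function.comp_apply, extChartAt_to_inv, ContinuousLinearMap.comp_zero,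
    zero_add] at hla hlx
  simp only [mvfderiv_eq_fderiv_comp_extChartAt_symm]
  exact (DFunLike.congr_fun hla X).trans (congrArg (_ + ·) (DFunLike.congr_fun hlx X)).symm

end ClmApply

section LieGroup

variable {E : Type*} [NormedAddCommGroup E] [NormedSpace ℝ E]
  {G : Type*} [TopologicalSpace G] [ChartedSpace E G] [Group G] [LieGroup 𝓘(ℝ, E) ∞ G]
  {V : Type*} [NormedAddCommGroup V] [NormedSpace ℝ V]

theorem mdifferentiable_mul_left (g : G) :
    MDifferentiable 𝓘(ℝ, E) 𝓘(ℝ, E) (fun h : G ↦ g * h) :=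
  (contMDiff_mul_left (n := ∞)).mdifferentiable (by simp)

theorem mdifferentiable_mul_right (g : G) :
    MDifferentiable 𝓘(ℝ, E) 𝓘(ℝ, E) (fun h : G ↦ h * g) :=
  (contMDiff_mul_right (n := ∞)).mdifferentiable (by simp)

theorem mdifferentiable_conj (g : G) :
    MDifferentiable 𝓘(ℝ, E) 𝓘(ℝ, E) (fun h : G ↦ g * h * g⁻¹) :=
  (mdifferentiable_mul_right g⁻¹).comp (mdifferentiable_mul_left g)

theorem mvfderiv_mulInvariantVectorField {ψ : G → V} {g : G}
    (hψ : MDifferentiableAt 𝓘(ℝ, E) 𝓘(ℝ, V) ψ g) (X : GroupLieAlgebra 𝓘(ℝ, E) G) :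
    mvfderiv 𝓘(ℝ, E) ψ g (mulInvariantVectorField X g) =
      mvfderiv 𝓘(ℝ, E) (fun h : G ↦ ψ (g * h)) 1 X :=
  (mfderiv_comp_apply_of_eq (I' := 𝓘(ℝ, E)) (1 : G) hψ (mdifferentiable_mul_left g 1)
    (mul_one g) X).symm

theorem mvfderiv_comp_conj {ψ : G → V} (hψ : MDifferentiableAt 𝓘(ℝ, E) 𝓘(ℝ, V) ψ 1) (g : G)
    (Y : GroupLieAlgebra 𝓘(ℝ, E) G) :
    mvfderiv 𝓘(ℝ, E) (fun h : G ↦ ψ (g * h * g⁻¹)) 1 Y = mvfderiv 𝓘(ℝ, E) ψ 1 (Ad E g Y) :=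
  mfderiv_comp_apply_of_eq (I' := 𝓘(ℝ, E)) (1 : G) hψ (mdifferentiable_conj g 1) (by simp) Y

theorem mvfderiv_lie [CompleteSpace E] {ψ : G → V} (hψ : ContMDiffAt 𝓘(ℝ, E) 𝓘(ℝ, V) 2 ψ 1)
    (X Y : GroupLieAlgebra 𝓘(ℝ, E) G) :
    mvfderiv 𝓘(ℝ, E) ψ 1 ⁅X, Y⁆ =
      mvfderiv 𝓘(ℝ, E) (fun g : G ↦ mvfderiv 𝓘(ℝ, E) (fun h : G ↦ ψ (g * h)) 1 Y) 1 X -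
        mvfderiv 𝓘(ℝ, E) (fun g : G ↦ mvfderiv 𝓘(ℝ, E) (fun h : G ↦ ψ (g * h)) 1 X) 1 Y := by
  have hdiff : ∀ᶠ g in 𝓝 (1 : G), MDifferentiableAt 𝓘(ℝ, E) 𝓘(ℝ, V) ψ g :=
    ((contMDiffAt_iff_contMDiffAt_nhds (by simp)).1 hψ).mono fun g hg ↦
      hg.mdifferentiableAt (by simp)
  have hfield (Z : GroupLieAlgebra 𝓘(ℝ, E) G) :
      mvfderiv 𝓘(ℝ, E) (fun g : G ↦ mvfderiv 𝓘(ℝ, E) ψ g (mulInvariantVectorField Z g)) 1 =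
        mvfderiv 𝓘(ℝ, E) (fun g : G ↦ mvfderiv 𝓘(ℝ, E) (fun h : G ↦ ψ (g * h)) 1 Z) 1 :=
    mvfderiv_congr (hdiff.mono fun g hg ↦ mvfderiv_mulInvariantVectorField hg Z)
  have hone (Z : GroupLieAlgebra 𝓘(ℝ, E) G) : mulInvariantVectorField Z (1 : G) = Z := by
    change mfderiv 𝓘(ℝ, E) 𝓘(ℝ, E) (fun h : G ↦ 1 * h) 1 Z = Z
    rw [show (fun h : G ↦ 1 * h) = id from funext one_mul, mfderiv_id]
    rfl
  have : IsManifold 𝓘(ℝ, E) 2 G := IsManifold.of_le (n := ∞) ENat.LEInfty.out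
  rw [GroupLieAlgebra.bracket_def, mvfderiv_mlieBracket hψ
    (mdifferentiableAt_mulInvariantVectorField X) (mdifferentiableAt_mulInvariantVectorField Y),
    hfield X, hfield Y, hone X, hone Y]

theorem contMDiffAt_comp_mul {ψ : G → V} (hψ : ContMDiffAt 𝓘(ℝ, E) 𝓘(ℝ, V) 2 ψ 1) :
    ContMDiffAt (𝓘(ℝ, E).prod 𝓘(ℝ, E)) 𝓘(ℝ, V) 2
      (Function.uncurry fun g h : G ↦ ψ (g * h)) (1, 1) := by
  refine ContMDiffAt.comp (I' := 𝓘(ℝ, E)) (g := ψ) (f := fun p : G × G ↦ p.1 * p.2) _ ?_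
    ((contMDiff_mul 𝓘(ℝ, E) ∞).contMDiffAt.of_le (n := ∞) ENat.LEInfty.out)
  simpa using hψ

theorem mvfderiv_mul_comm {ψ : G → V} (hψ : ContMDiffAt 𝓘(ℝ, E) 𝓘(ℝ, V) 2 ψ 1)
    (X Y : GroupLieAlgebra 𝓘(ℝ, E) G) :
    mvfderiv 𝓘(ℝ, E) (fun g : G ↦ mvfderiv 𝓘(ℝ, E) (fun h : G ↦ ψ (h * g)) 1 Y) 1 X =
      mvfderiv 𝓘(ℝ, E) (fun g : G ↦ mvfderiv 𝓘(ℝ, E) (fun h : G ↦ ψ (g * h)) 1 X) 1 Y := by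
  have : IsManifold 𝓘(ℝ, E) 2 G := IsManifold.of_le (n := ∞) ENat.LEInfty.out
  exact (mvfderiv_mvfderiv_comm (contMDiffAt_comp_mul hψ) Y X).symm

variable (E) in
/-- `Ad_g` as a continuous linear endomorphism of the model space `E`, which carries the norm. -/
def adCLM (g : G) : E →L[ℝ] E :=
  mfderiv 𝓘(ℝ, E) 𝓘(ℝ, E) (fun h : G ↦ g * h * g⁻¹) 1

variable (E) in
/-- The curve `g ↦ Ad_{g⁻¹} Y` read in the model space `E`. -/
def adInv (Y : E) (g : G) : E := adCLM E g⁻¹ Y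

theorem adCLM_mul_apply (g h : G) (Y : E) : adCLM E (g * h) Y = adCLM E g (adCLM E h Y) :=
  DFunLike.congr_fun (Ad_mul (E := E) g h) Y

omit [LieGroup 𝓘(ℝ, E) ∞ G] in
theorem adInv_one (Y : E) : adInv E Y (1 : G) = Y := by
  rw [adInv, inv_one]
  exact DFunLike.congr_fun (Ad_one (E := E) (G := G)) Y

theorem adInv_mul (g h : G) (Y : E) : adInv E Y (g * h) = adCLM E h⁻¹ (adInv E Y g) := by
  rw [adInv, mul_inv_rev, adCLM_mul_apply, adInv]

theorem adInv_conj (g h : G) (Y : E) :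
    adInv E (adCLM E g Y) (g * h * g⁻¹) = adCLM E g (adInv E Y h) := by
  simp only [adInv, ← adCLM_mul_apply]
  group

theorem mvfderiv_extChartAt_one :
    mvfderiv 𝓘(ℝ, E) (extChartAt 𝓘(ℝ, E) (1 : G)) 1 = ContinuousLinearMap.id ℝ E := by
  have : IsManifold 𝓘(ℝ, E) 1 G := IsManifold.of_le (n := ∞) ENat.LEInfty.out
  exact mfderiv_extChartAt_self

theorem adInv_eq_mvfderiv (Y : E) (g : G) :
    adInv E Y g =
      mvfderiv 𝓘(ℝ, E) (fun h : G ↦ extChartAt 𝓘(ℝ, E) (1 : G) (g⁻¹ * h * g⁻¹⁻¹)) 1 Y := by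
  have hchart : ContMDiffAt 𝓘(ℝ, E) 𝓘(ℝ, E) ∞ (extChartAt 𝓘(ℝ, E) (1 : G)) 1 :=
    contMDiffAt_extChartAt
  refine .trans ?_ (mvfderiv_comp_conj (hchart.mdifferentiableAt (by simp)) g⁻¹ Y).symm
  rw [mvfderiv_extChartAt_one]
  rfl

theorem mdifferentiableAt_adInv_one (Y : E) :
    MDifferentiableAt 𝓘(ℝ, E) 𝓘(ℝ, E) (adInv E Y : G → E) 1 := by
  have : IsManifold 𝓘(ℝ, E) 2 G := IsManifold.of_le (n := ∞) ENat.LEInfty.out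
  have hconj : ContMDiff (𝓘(ℝ, E).prod 𝓘(ℝ, E)) 𝓘(ℝ, E) ∞
      (fun p : G × G ↦ p.1⁻¹ * p.2 * p.1⁻¹⁻¹) :=
    (contMDiff_fst.inv.mul contMDiff_snd).mul contMDiff_fst.inv.inv
  have hchart : ContMDiffAt (𝓘(ℝ, E).prod 𝓘(ℝ, E)) 𝓘(ℝ, E) 2
      (Function.uncurry fun g h : G ↦ extChartAt 𝓘(ℝ, E) (1 : G) (g⁻¹ * h * g⁻¹⁻¹)) (1, 1) := by
    refine ContMDiffAt.comp (I' := 𝓘(ℝ, E)) (g := extChartAt 𝓘(ℝ, E) (1 : G)) _ ?_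
      (hconj.contMDiffAt.of_le (n := ∞) ENat.LEInfty.out)
    rw [inv_one, one_mul, inv_one, mul_one]
    exact contMDiffAt_extChartAt
  rw [funext (adInv_eq_mvfderiv Y)]
  exact (mdifferentiableAt_mvfderiv_right hchart).clm_apply mdifferentiableAt_const

theorem continuous_adInv (Y : E) : Continuous (adInv E Y : G → E) := by
  have : IsTopologicalGroup G := topologicalGroup_of_lieGroup 𝓘(ℝ, E) ∞
  refine continuous_iff_continuousAt.2 fun g ↦ ?_
  have htranslate : (adInv E Y : G → E) = fun k ↦ adCLM E g⁻¹ (adInv E Y (k * g⁻¹)) := by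
    ext k
    rw [← adInv_mul, inv_mul_cancel_right]
  rw [htranslate]
  refine (adCLM E g⁻¹).continuous.continuousAt.comp
    (ContinuousAt.comp (g := (adInv E Y : G → E)) ?_ (by fun_prop))
  rw [mul_inv_cancel]
  exact (mdifferentiableAt_adInv_one Y).continuousAt

theorem mvfderiv_mul_eq_mvfderiv_adInv {ψ : G → V} {g : G}
    (hψ : MDifferentiableAt 𝓘(ℝ, E) 𝓘(ℝ, V) ψ g) (Y : E) :
    mvfderiv 𝓘(ℝ, E) (fun h : G ↦ ψ (h * g)) 1 Y =
      mvfderiv 𝓘(ℝ, E) (fun h : G ↦ ψ (g * h)) 1 (adInv E Y g) := by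
  have hψ' : MDifferentiableAt 𝓘(ℝ, E) 𝓘(ℝ, V) (fun h ↦ ψ (g * h)) 1 :=
    MDifferentiableAt.comp (I' := 𝓘(ℝ, E)) (g := ψ) 1 (by rwa [mul_one])
      (mdifferentiable_mul_left g 1)
  refine .trans ?_ (mvfderiv_comp_conj (ψ := fun h ↦ ψ (g * h)) hψ' g⁻¹ Y)
  congr 2
  ext h
  simp [mul_assoc]

theorem mvfderiv_adInv [CompleteSpace E] (X Y : GroupLieAlgebra 𝓘(ℝ, E) G) :
    mvfderiv 𝓘(ℝ, E) (adInv E Y : G → E) 1 X = (-⁅X, Y⁆ : GroupLieAlgebra 𝓘(ℝ, E) G) := by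
  have : IsManifold 𝓘(ℝ, E) 2 G := IsManifold.of_le (n := ∞) ENat.LEInfty.out
  let ψ : G → E := extChartAt 𝓘(ℝ, E) (1 : G)
  have hψ : ContMDiffAt 𝓘(ℝ, E) 𝓘(ℝ, E) 2 ψ 1 := contMDiffAt_extChartAt
  -- differentiate `ψ (h g) = ψ (g (g⁻¹ h g))` first in `h` and then in `g`
  have hconj : ∀ᶠ g in 𝓝 (1 : G), mvfderiv 𝓘(ℝ, E) (fun h : G ↦ ψ (h * g)) 1 Y =
      mvfderiv 𝓘(ℝ, E) (fun h : G ↦ ψ (g * h)) 1 (adInv E Y g) :=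
    ((contMDiffAt_iff_contMDiffAt_nhds (by simp)).1 hψ).mono fun g hg ↦
      mvfderiv_mul_eq_mvfderiv_adInv (hg.mdifferentiableAt (by simp)) Y
  have hproduct := mvfderiv_clm_apply (mdifferentiableAt_mvfderiv_right (contMDiffAt_comp_mul hψ))
    (mdifferentiableAt_adInv_one (E := E) (G := G) Y) X
  have hcomm := mvfderiv_mul_comm hψ X Y
  rw [mvfderiv_congr hconj] at hcomm
  rw [show adInv E Y (1 : G) = Y from adInv_one (E := E) Y] at hproduct
  simp only [one_mul] at hproduct
  have hψD : mvfderiv 𝓘(ℝ, E) ψ 1 (mvfderiv 𝓘(ℝ, E) (adInv E Y : G → E) 1 X) =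
      -mvfderiv 𝓘(ℝ, E) ψ 1 ⁅X, Y⁆ := by
    rw [mvfderiv_lie hψ, neg_sub, ← hcomm]
    exact eq_sub_of_add_eq hproduct.symm
  rwa [mvfderiv_extChartAt_one] at hψD

theorem Ad_lie [CompleteSpace E] (g : G) (X Y : GroupLieAlgebra 𝓘(ℝ, E) G) :
    Ad E g ⁅X, Y⁆ = ⁅Ad E g X, Ad E g Y⁆ := by
  have hconj : (fun h : G ↦ adCLM E g (adInv E Y h)) =
      fun h : G ↦ adInv E (adCLM E g Y) (g * h * g⁻¹) :=
    funext fun h ↦ (adInv_conj (E := E) (G := G) g h Y).symm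
  have hD := mdifferentiableAt_adInv_one (E := E) (G := G)
  have hleft := mvfderiv_comp_conj (hD (adCLM E g Y)) g X
  rw [← hconj] at hleft
  have hright := ((adCLM E g).hasFDerivAt.hasMFDerivAt.comp 1 (hD Y).hasMFDerivAt).mfderiv
  have hneg : (-⁅Ad E g X, Ad E g Y⁆ : GroupLieAlgebra 𝓘(ℝ, E) G) = Ad E g (-⁅X, Y⁆) :=
    (mvfderiv_adInv (Ad E g X) (Ad E g Y)).symm.trans <|
      hleft.symm.trans <| (DFunLike.congr_fun hright X).trans <|
        congrArg (adCLM E g) (mvfderiv_adInv X Y)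
  exact (neg_injective ((map_neg (Ad E g) _).symm.trans hneg.symm))

end LieGroup

section IdentityComponent

variable {E : Type*} [NormedAddCommGroup E] [NormedSpace ℝ E]
  {V : Type*} [NormedAddCommGroup V] [NormedSpace ℝ V]

theorem hasMFDerivAt_zero_of_comp {M N : Type*} [TopologicalSpace M] [ChartedSpace E M]
    [TopologicalSpace N] [ChartedSpace E N] {ψ : M → V} {φ : N → M} {χ : M → N} {x : M} {y : N}
    (hφχ : Function.LeftInverse φ χ) (hχ : MDifferentiableAt 𝓘(ℝ, E) 𝓘(ℝ, E) χ x)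
    (hy : χ x = y) (hψφ : HasMFDerivAt 𝓘(ℝ, E) 𝓘(ℝ, V) (ψ ∘ φ) y 0) :
    HasMFDerivAt 𝓘(ℝ, E) 𝓘(ℝ, V) ψ x 0 := by
  subst hy
  have hcomp := hψφ.comp x hχ.hasMFDerivAt
  rwa [ContinuousLinearMap.zero_comp, Function.comp_assoc, hφχ.comp_eq_id] at hcomp

variable {G : Type*} [TopologicalSpace G] [ChartedSpace E G] [Group G] [LieGroup 𝓘(ℝ, E) ∞ G]

theorem eq_apply_one_of_hasMFDerivAt_zero {f : G → V}
    (hf : ∀ g ∈ connectedComponent (1 : G), HasMFDerivAt 𝓘(ℝ, E) 𝓘(ℝ, V) f g 0) {g : G}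
    (hg : g ∈ connectedComponent (1 : G)) : f g = f 1 := by
  have : LocallyConnectedSpace G := ChartedSpace.locallyConnectedSpace E G
  have : IsManifold 𝓘(ℝ, E) 1 G := IsManifold.of_le (n := ∞) ENat.LEInfty.out
  exact eq_of_hasMFDerivAt_zero isOpen_connectedComponent isPreconnected_connectedComponent hf
    hg mem_connectedComponent

theorem eq_apply_one_of_hasMFDerivAt_mul_left_zero {f : G → V}
    (hf : ∀ g ∈ connectedComponent (1 : G),
      HasMFDerivAt 𝓘(ℝ, E) 𝓘(ℝ, V) (fun k ↦ f (g * k)) 1 0) {g : G}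
    (hg : g ∈ connectedComponent (1 : G)) : f g = f 1 :=
  eq_apply_one_of_hasMFDerivAt_zero (E := E) (fun k hk ↦ hasMFDerivAt_zero_of_comp
    (mul_inv_cancel_left k) (mdifferentiable_mul_left k⁻¹ k) (inv_mul_cancel k) (hf k hk)) hg

theorem eq_apply_one_of_hasMFDerivAt_mul_right_zero {f : G → V}
    (hf : ∀ g ∈ connectedComponent (1 : G),
      HasMFDerivAt 𝓘(ℝ, E) 𝓘(ℝ, V) (fun k ↦ f (k * g)) 1 0) {g : G}
    (hg : g ∈ connectedComponent (1 : G)) : f g = f 1 :=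
  eq_apply_one_of_hasMFDerivAt_zero (E := E) (fun k hk ↦ hasMFDerivAt_zero_of_comp
    (fun j ↦ inv_mul_cancel_right j k) (mdifferentiable_mul_right k⁻¹ k) (mul_inv_cancel k)
    (hf k hk)) hg

end IdentityComponent

section PoissonAlgebra

variable {F : Type*} [NormedAddCommGroup F] [NormedSpace ℝ F]
  {P : Type*} [TopologicalSpace P] [ChartedSpace F P] (π : PoissonStructure F P)

theorem PoissonStructure.neg_bracket (f h : Smooth F P) : -π.bracket h f = π.bracket f h :=
  LinearMap.IsAlt.neg π.alternating h f

variable {π} in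
theorem mem_casimir_iff_bracket_right {c : Smooth F P} :
    c ∈ Casimir π ↔ ∀ f, π.bracket f c = 0 :=
  forall_congr' fun f ↦ by rw [← π.neg_bracket, neg_eq_zero]

theorem PoissonStructure.bracket_bracket_right (f h k : Smooth F P) :
    π.bracket f (π.bracket h k) =
      π.bracket (π.bracket f h) k - π.bracket (π.bracket f k) h := by
  have hjacobi := π.jacobi f h k
  rw [← π.neg_bracket k f, map_neg, ← π.neg_bracket h (π.bracket f k),
    ← π.neg_bracket k (π.bracket f h), neg_neg] at hjacobi
  linear_combination (exp := 1) hjacobi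

end PoissonAlgebra

section InfinitesimalAction

variable {E : Type*} [NormedAddCommGroup E] [NormedSpace ℝ E]
  {F : Type*} [NormedAddCommGroup F] [NormedSpace ℝ F]
  {G : Type*} [TopologicalSpace G] [ChartedSpace E G] [Group G]
  {P : Type*} [TopologicalSpace P] [ChartedSpace F P] [MulAction G P]
  [ContMDiffSMul 𝓘(ℝ, E) 𝓘(ℝ, F) ∞ G P]

theorem contMDiff_orbit (f : Smooth F P) (x : P) :
    ContMDiff 𝓘(ℝ, E) 𝓘(ℝ, ℝ) ∞ (fun g : G ↦ f (g • x)) :=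
  f.contMDiff.comp
    ((contMDiff_smul (I := 𝓘(ℝ, E)) (I' := 𝓘(ℝ, F)) (n := ∞) (G := G) (M := P)).comp
      (contMDiff_id.prodMk contMDiff_const))

theorem translate_translate_inv (g : G) (f : Smooth F P) :
    translate E g (translate E g⁻¹ f) = f := by
  ext x
  exact congrArg f (inv_smul_smul g x)

theorem mdifferentiable_orbit (f : Smooth F P) (x : P) :
    MDifferentiable 𝓘(ℝ, E) 𝓘(ℝ, ℝ) (fun g : G ↦ f (g • x)) :=
  (contMDiff_orbit f x).mdifferentiable (by simp)

variable [LieGroup 𝓘(ℝ, E) ∞ G]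

theorem infinitesimalAction_translate_inv (g : G) (Y : GroupLieAlgebra 𝓘(ℝ, E) G)
    (f : Smooth F P) (x : P) :
    infinitesimalAction Y (translate E g⁻¹ f) (g • x) =
      infinitesimalAction (Ad E g⁻¹ Y) f x := by
  refine .trans ?_ (mvfderiv_comp_conj (mdifferentiable_orbit f x 1) g⁻¹ Y)
  change mvfderiv 𝓘(ℝ, E) (fun h : G ↦ f (g⁻¹ • h • g • x)) 1 Y = _
  simp only [inv_inv, mul_smul]

theorem infinitesimalAction_lie [CompleteSpace E] (X Y : GroupLieAlgebra 𝓘(ℝ, E) G)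
    (f : Smooth F P) (x : P) :
    infinitesimalAction ⁅X, Y⁆ f x =
      mvfderiv 𝓘(ℝ, E) (fun g : G ↦ infinitesimalAction X f (g • x)) 1 Y -
        mvfderiv 𝓘(ℝ, E) (fun g : G ↦ infinitesimalAction Y f (g • x)) 1 X := by
  have hψ : ContMDiffAt 𝓘(ℝ, E) 𝓘(ℝ, ℝ) 2 (fun g : G ↦ f (g • x)) 1 :=
    (contMDiff_orbit f x).contMDiffAt.of_le (n := ∞) ENat.LEInfty.out
  refine (mvfderiv_lie hψ X Y).trans ?_
  rw [← mvfderiv_mul_comm hψ X Y, ← mvfderiv_mul_comm hψ Y X]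
  simp only [mul_smul]
  rfl

end InfinitesimalAction

section Components

variable {E : Type*} [NormedAddCommGroup E] [NormedSpace ℝ E]
  {F : Type*} [NormedAddCommGroup F] [NormedSpace ℝ F]
  {G : Type*} [TopologicalSpace G] [ChartedSpace E G] [Group G]
  {P : Type*} [TopologicalSpace P] [ChartedSpace F P] {π : PoissonStructure F P}

theorem SmoothMapToDual.ext {m m' : SmoothMapToDual E F G P}
    (h : ∀ X, m.component X = m'.component X) : m = m' := by
  cases m
  cases m'
  congr
  ext x X
  exact DFunLike.congr_fun (h X) x

/-- The linear map `X ↦ m(X)` from the Lie algebra to the smooth functions. -/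
def SmoothMapToDual.componentLinear (m : SmoothMapToDual E F G P) :
    GroupLieAlgebra 𝓘(ℝ, E) G →ₗ[ℝ] Smooth F P where
  toFun := m.component
  map_add' X Y := by ext x; exact map_add (m.toFun x) X Y
  map_smul' t X := by ext x; exact map_smul (m.toFun x) t X

theorem SmoothMapToDual.component_add (m : SmoothMapToDual E F G P)
    (X Y : GroupLieAlgebra 𝓘(ℝ, E) G) :
    m.component (X + Y) = m.component X + m.component Y :=
  map_add m.componentLinear X Y

theorem SmoothMapToDual.component_smul (m : SmoothMapToDual E F G P) (t : ℝ)
    (X : GroupLieAlgebra 𝓘(ℝ, E) G) : m.component (t • X) = t • m.component X :=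
  map_smul m.componentLinear t X

/-- The map `m + c`, for a linear map `c : 𝔤 → Car(P)`. -/
def SmoothMapToDual.addCasimir (m : SmoothMapToDual E F G P)
    (c : GroupLieAlgebra 𝓘(ℝ, E) G →ₗ[ℝ] Casimir π) : SmoothMapToDual E F G P where
  toFun x :=
    { toFun := fun X ↦ (m.component X + (c X).1) x
      map_add' := fun X Y ↦ DFunLike.congr_fun
        (map_add (m.componentLinear + (Casimir π).subtype ∘ₗ c) X Y) x
      map_smul' := fun t X ↦ DFunLike.congr_fun
        (map_smul (m.componentLinear + (Casimir π).subtype ∘ₗ c) t X) x }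
  smooth X := (m.component X + (c X).1).contMDiff

theorem SmoothMapToDual.component_addCasimir (m : SmoothMapToDual E F G P)
    (c : GroupLieAlgebra 𝓘(ℝ, E) G →ₗ[ℝ] Casimir π) (X : GroupLieAlgebra 𝓘(ℝ, E) G) :
    (m.addCasimir c).component X = m.component X + (c X).1 := rfl

variable [MulAction G P] {m m' : SmoothMapToDual E F G P}

theorem SmoothMapToDual.isCoadjointEquivariant_iff_defect_eq_zero :
    m.IsCoadjointEquivariant ↔ ∀ g x, m.defect g x = 0 :=
  forall₂_congr fun _ _ ↦ sub_eq_zero.symm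

theorem IsMomentumMap.addCasimir (hm : IsMomentumMap π m)
    (c : GroupLieAlgebra 𝓘(ℝ, E) G →ₗ[ℝ] Casimir π) : IsMomentumMap π (m.addCasimir c) := by
  intro X f x
  rw [hm, m.component_addCasimir, map_add, mem_casimir_iff_bracket_right.1 (c X).2, add_zero]

theorem IsMomentumMap.component_sub_mem_casimir (hm' : IsMomentumMap π m')
    (hm : IsMomentumMap π m) (X : GroupLieAlgebra 𝓘(ℝ, E) G) :
    m'.component X - m.component X ∈ Casimir π :=
  mem_casimir_iff_bracket_right.2 fun f ↦ by
    ext x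
    rw [map_sub]
    exact sub_eq_zero.2 ((hm' X f x).symm.trans (hm X f x))

/-- The difference `m' - m` of two momentum maps, as a linear map `𝔤 → Car(P)`. -/
def momentumDifference (hm' : IsMomentumMap π m') (hm : IsMomentumMap π m) :
    GroupLieAlgebra 𝓘(ℝ, E) G →ₗ[ℝ] Casimir π :=
  (m'.componentLinear - m.componentLinear).codRestrict (Casimir π)
    (hm'.component_sub_mem_casimir hm)

theorem addCasimir_momentumDifference (hm' : IsMomentumMap π m') (hm : IsMomentumMap π m) :
    m.addCasimir (momentumDifference hm' hm) = m' :=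
  SmoothMapToDual.ext fun X ↦ add_sub_cancel (m.component X) (m'.component X)

end Components

section LieCocycle

variable {E : Type*} [NormedAddCommGroup E] [NormedSpace ℝ E] [CompleteSpace E]
  {F : Type*} [NormedAddCommGroup F] [NormedSpace ℝ F]
  {G : Type*} [TopologicalSpace G] [ChartedSpace E G] [Group G] [LieGroup 𝓘(ℝ, E) ∞ G]
  {P : Type*} [TopologicalSpace P] [ChartedSpace F P] [MulAction G P]
  [ContMDiffSMul 𝓘(ℝ, E) 𝓘(ℝ, F) ∞ G P]
  {π : PoissonStructure F P} {m : SmoothMapToDual E F G P}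

theorem IsMomentumMap.bracket_component_lie (hm : IsMomentumMap π m)
    (X Y : GroupLieAlgebra 𝓘(ℝ, E) G) (f : Smooth F P) :
    π.bracket f (m.component ⁅X, Y⁆) =
      π.bracket f (π.bracket (m.component X) (m.component Y)) := by
  ext x
  rw [π.bracket_bracket_right, ← hm, infinitesimalAction_lie]
  simp only [hm _ f]
  exact congrArg₂ (· - ·) (hm Y (π.bracket f (m.component X)) x)
    (hm X (π.bracket f (m.component Y)) x)

theorem IsMomentumMap.component_lie_sub_bracket_mem_casimir (hm : IsMomentumMap π m)
    (X Y : GroupLieAlgebra 𝓘(ℝ, E) G) :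
    m.component ⁅X, Y⁆ - π.bracket (m.component X) (m.component Y) ∈ Casimir π :=
  mem_casimir_iff_bracket_right.2 fun f ↦ by
    rw [map_sub, hm.bracket_component_lie, sub_self]

/-- The cocycle `Γ_{X, Y} = m([X, Y]) - {m(X), m(Y)}` of a momentum map `m`. -/
def lieCocycle (hm : IsMomentumMap π m) :
    GroupLieAlgebra 𝓘(ℝ, E) G →ₗ[ℝ] GroupLieAlgebra 𝓘(ℝ, E) G →ₗ[ℝ] Casimir π :=
  LinearMap.mk₂ ℝ (fun X Y ↦ ⟨_, hm.component_lie_sub_bracket_mem_casimir X Y⟩)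
    (fun X X' Y ↦ Subtype.ext <| by
      simp only [add_lie, m.component_add, map_add, LinearMap.add_apply, Submodule.coe_add]
      abel)
    (fun t X Y ↦ Subtype.ext <| by
      simp only [smul_lie, m.component_smul, map_smul, LinearMap.smul_apply, smul_sub,
        Submodule.coe_smul])
    (fun X Y Y' ↦ Subtype.ext <| by
      simp only [lie_add, m.component_add, map_add, Submodule.coe_add]
      abel)
    (fun t X Y ↦ Subtype.ext <| by
      simp only [lie_smul, m.component_smul, map_smul, smul_sub, Submodule.coe_smul])

theorem lieCocycle_coe (hm : IsMomentumMap π m) (X Y : GroupLieAlgebra 𝓘(ℝ, E) G) :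
    (lieCocycle hm X Y : Smooth F P) =
      m.component ⁅X, Y⁆ - π.bracket (m.component X) (m.component Y) := rfl

theorem lieCocycle_self (hm : IsMomentumMap π m) (X : GroupLieAlgebra 𝓘(ℝ, E) G) :
    lieCocycle hm X X = 0 := by
  apply Subtype.ext
  rw [lieCocycle_coe, lie_self, π.alternating, sub_zero]
  exact map_zero m.componentLinear

theorem lieCocycle_lie_right (hm : IsMomentumMap π m) (X Y Z : GroupLieAlgebra 𝓘(ℝ, E) G) :
    lieCocycle hm X ⁅Y, Z⁆ = lieCocycle hm ⁅X, Y⁆ Z + lieCocycle hm Y ⁅X, Z⁆ := by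
  have hleibniz : m.component ⁅X, ⁅Y, Z⁆⁆ = m.component ⁅⁅X, Y⁆, Z⁆ + m.component ⁅Y, ⁅X, Z⁆⁆ := by
    rw [leibniz_lie X Y Z]
    exact map_add m.componentLinear _ _
  have hbracket : π.bracket (m.component ⁅X, Y⁆) (m.component Z) =
      π.bracket (π.bracket (m.component X) (m.component Y)) (m.component Z) := by
    rw [← π.neg_bracket, hm.bracket_component_lie, π.neg_bracket]
  apply Subtype.ext
  rw [Submodule.coe_add, lieCocycle_coe, lieCocycle_coe, lieCocycle_coe, hbracket,
    hm.bracket_component_lie, hm.bracket_component_lie, hleibniz,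
    π.bracket_bracket_right (m.component X), ← π.neg_bracket (m.component Y)]
  abel

/-- `Γ` as a `2`-cochain with values in the trivial module `Car(P)`. -/
def lieTwoCochain (hm : IsMomentumMap π m) :
    LieModule.Cohomology.twoCochain ℝ (GroupLieAlgebra 𝓘(ℝ, E) G) (TrivialCasimir E G π) :=
  ⟨(lieCocycle hm).compr₂ (TrivialLieModule.equiv ℝ _ (Casimir π)).symm.toLinearMap, fun X ↦ by
    rw [LinearMap.compr₂_apply, lieCocycle_self, map_zero]⟩

theorem lieTwoCochain_apply (hm : IsMomentumMap π m) (X Y : GroupLieAlgebra 𝓘(ℝ, E) G) :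
    lieTwoCochain hm X Y = (TrivialLieModule.equiv ℝ (GroupLieAlgebra 𝓘(ℝ, E) G)
      (Casimir π)).symm (lieCocycle hm X Y) := rfl

theorem lieTwoCochain_mem_twoCocycle (hm : IsMomentumMap π m) :
    lieTwoCochain hm ∈ LieModule.Cohomology.twoCocycle ℝ (GroupLieAlgebra 𝓘(ℝ, E) G)
      (TrivialCasimir E G π) := by
  rw [LieModule.Cohomology.mem_twoCocycle_iff_of_trivial]
  intro X Y Z
  simp only [lieTwoCochain_apply, lieCocycle_lie_right hm X Y Z, map_add]

omit [CompleteSpace E] in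
theorem mdifferentiableAt_defect [FiniteDimensional ℝ E] (m : SmoothMapToDual E F G P) (x : P)
    (Y : GroupLieAlgebra 𝓘(ℝ, E) G) :
    MDifferentiableAt 𝓘(ℝ, E) 𝓘(ℝ, ℝ) (fun g : G ↦ m.defect g x Y) 1 :=
  (mdifferentiable_orbit (m.component Y) x 1).sub <|
    (LinearMap.toContinuousLinearMap (show E →ₗ[ℝ] ℝ from m.toFun x)).mdifferentiableAt.comp 1
      (mdifferentiableAt_adInv_one (E := E) Y)

theorem mfderiv_defect [FiniteDimensional ℝ E] (hm : IsMomentumMap π m)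
    (X Y : GroupLieAlgebra 𝓘(ℝ, E) G) (x : P) :
    mfderiv 𝓘(ℝ, E) 𝓘(ℝ, ℝ) (fun g : G ↦ m.defect g x Y) 1 X = (lieCocycle hm X Y).1 x := by
  let ξ : E →L[ℝ] ℝ := LinearMap.toContinuousLinearMap (show E →ₗ[ℝ] ℝ from m.toFun x)
  have hcoadjoint := ξ.hasFDerivAt.hasMFDerivAt.comp 1
    (mdifferentiableAt_adInv_one (E := E) (G := G) Y).hasMFDerivAt
  have hdefect := ((mdifferentiable_orbit (m.component Y) x 1).hasMFDerivAt.sub hcoadjoint).mfderiv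
  have hξ : ξ (mvfderiv 𝓘(ℝ, E) (adInv E Y : G → E) 1 X) = -m.component ⁅X, Y⁆ x :=
    (congrArg ξ (mvfderiv_adInv X Y)).trans (map_neg (m.toFun x) _)
  calc mvfderiv 𝓘(ℝ, E) (fun g : G ↦ m.defect g x Y) 1 X
    _ = infinitesimalAction X (m.component Y) x -
          ξ (mvfderiv 𝓘(ℝ, E) (adInv E Y : G → E) 1 X) := DFunLike.congr_fun hdefect X
    _ = (m.component ⁅X, Y⁆ + π.bracket (m.component Y) (m.component X)) x := by
      rw [hξ, hm, sub_neg_eq_add, add_comm]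
      rfl
    _ = (lieCocycle hm X Y).1 x := by
      rw [lieCocycle_coe, ← π.neg_bracket, ← sub_eq_add_neg]

end LieCocycle

section GroupCocycle

variable {E : Type*} [NormedAddCommGroup E] [NormedSpace ℝ E]
  {F : Type*} [NormedAddCommGroup F] [NormedSpace ℝ F]
  {G : Type*} [TopologicalSpace G] [ChartedSpace E G] [Group G] [LieGroup 𝓘(ℝ, E) ∞ G]
  {P : Type*} [TopologicalSpace P] [ChartedSpace F P] [MulAction G P]
  {π : PoissonStructure F P} {m : SmoothMapToDual E F G P}

theorem SmoothMapToDual.defect_mul (m : SmoothMapToDual E F G P) (g h : G) (x : P)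
    (Y : GroupLieAlgebra 𝓘(ℝ, E) G) :
    m.defect (g * h) x Y = m.defect g (h • x) Y + m.defect h x (Ad E g⁻¹ Y) := by
  simp only [defect, LinearMap.sub_apply, LinearMap.comp_apply, mul_smul, mul_inv_rev, Ad_mul]
  abel

variable [ContMDiffSMul 𝓘(ℝ, E) 𝓘(ℝ, F) ∞ G P]

theorem IsMomentumMap.bracket_translate (hPoisson : IsPoissonAction E G π)
    (hm : IsMomentumMap π m) (g : G) (Y : GroupLieAlgebra 𝓘(ℝ, E) G) (f : Smooth F P) :
    π.bracket f (translate E g (m.component Y)) = π.bracket f (m.component (Ad E g⁻¹ Y)) := by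
  ext x
  calc π.bracket f (translate E g (m.component Y)) x
    _ = π.bracket (translate E g (translate E g⁻¹ f)) (translate E g (m.component Y)) x := by
      rw [translate_translate_inv]
    _ = π.bracket (translate E g⁻¹ f) (m.component Y) (g • x) := by
      rw [hPoisson]
      rfl
    _ = infinitesimalAction (Ad E g⁻¹ Y) f x := by
      rw [← hm, infinitesimalAction_translate_inv]
    _ = π.bracket f (m.component (Ad E g⁻¹ Y)) x := hm _ f x

/-- The cocycle `Ψ(g)(Y) = ⟨Σ(g, ·), Y⟩` of a momentum map `m`. -/
def groupCocycle (hPoisson : IsPoissonAction E G π) (hm : IsMomentumMap π m) (g : G) :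
    GroupLieAlgebra 𝓘(ℝ, E) G →ₗ[ℝ] Casimir π where
  toFun Y := ⟨translate E g (m.component Y) - m.component (Ad E g⁻¹ Y),
    mem_casimir_iff_bracket_right.2 fun f ↦ by
      rw [map_sub, hm.bracket_translate hPoisson, sub_self]⟩
  map_add' X Y := by
    ext x
    exact map_add (m.defect g x) X Y
  map_smul' t X := by
    ext x
    exact map_smul (m.defect g x) t X

theorem groupCocycle_coe_apply (hPoisson : IsPoissonAction E G π) (hm : IsMomentumMap π m) (g : G)
    (Y : GroupLieAlgebra 𝓘(ℝ, E) G) (x : P) :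
    (groupCocycle hPoisson hm g Y).1 x = m.defect g x Y := rfl

theorem isCoadjointEquivariant_iff_groupCocycle_eq_zero (hPoisson : IsPoissonAction E G π)
    (hm : IsMomentumMap π m) :
    m.IsCoadjointEquivariant ↔ ∀ g : G, groupCocycle hPoisson hm g = 0 := by
  rw [m.isCoadjointEquivariant_iff_defect_eq_zero]
  refine forall_congr' fun g ↦ ⟨fun h ↦ ?_, fun h x ↦ ?_⟩
  · ext Y x
    exact DFunLike.congr_fun (h x) Y
  · ext Y
    exact congrArg (fun ψ ↦ (ψ Y).1 x) h

theorem IsMomentumMap.casimir_smul (hm : IsMomentumMap π m) {c : Smooth F P}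
    (hc : c ∈ Casimir π) {g : G} (hg : g ∈ connectedComponent (1 : G)) (x : P) :
    c (g • x) = c x := by
  refine (eq_apply_one_of_hasMFDerivAt_mul_right_zero (E := E) (f := fun k : G ↦ c (k • x))
    (fun k _ ↦ ?_) hg).trans (congrArg c (one_smul G x))
  have hderiv : mvfderiv 𝓘(ℝ, E) (fun j : G ↦ c (j • k • x)) 1 = 0 := by
    ext X
    exact (hm X c (k • x)).trans (DFunLike.congr_fun (hc _) (k • x))
  have horbit := (mdifferentiable_orbit c (k • x) (1 : G)).hasMFDerivAt.congr_mfderiv hderiv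
  exact horbit.congr_of_eventuallyEq (.of_forall fun j ↦ congrArg c (mul_smul j k x))

theorem groupCocycle_mul (hPoisson : IsPoissonAction E G π) (hm : IsMomentumMap π m) (g : G)
    {h : G} (hh : h ∈ connectedComponent (1 : G)) :
    groupCocycle hPoisson hm (g * h) = groupCocycle hPoisson hm g +
      coadjointRep E G (Casimir π) g (groupCocycle hPoisson hm h) := by
  ext Y x
  exact (m.defect_mul g h x Y).trans <|
    congrArg (· + _) (hm.casimir_smul (groupCocycle hPoisson hm g Y).2 hh x)

theorem groupCocycle_addCasimir (hPoisson : IsPoissonAction E G π) (hm : IsMomentumMap π m)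
    (c : GroupLieAlgebra 𝓘(ℝ, E) G →ₗ[ℝ] Casimir π) {g : G}
    (hg : g ∈ connectedComponent (1 : G)) :
    groupCocycle hPoisson (hm.addCasimir c) g =
      groupCocycle hPoisson hm g - (coadjointRep E G (Casimir π) g c - c) := by
  ext Y x
  have hc : (c Y).1 (g • x) = (c Y).1 x := hm.casimir_smul (c Y).2 hg x
  change m.component Y (g • x) + (c Y).1 (g • x) -
      (m.component (Ad E g⁻¹ Y) x + (c (Ad E g⁻¹ Y)).1 x) =
    m.component Y (g • x) - m.component (Ad E g⁻¹ Y) x - ((c (Ad E g⁻¹ Y)).1 x - (c Y).1 x)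
  rw [hc]
  ring

theorem isGroupOneCocycle_groupCocycle [PreconnectedSpace G] (hPoisson : IsPoissonAction E G π)
    (hm : IsMomentumMap π m) :
    IsGroupOneCocycle (coadjointRep E G (Casimir π)) (groupCocycle hPoisson hm) :=
  fun g h ↦ groupCocycle_mul hPoisson hm g <| by
    simp only [PreconnectedSpace.connectedComponent_eq_univ, Set.mem_univ]

theorem hasEquivariantMomentumMap_iff_isGroupOneCoboundary [PreconnectedSpace G]
    (hPoisson : IsPoissonAction E G π) (hm : IsMomentumMap π m) :
    HasEquivariantMomentumMap E G π ↔
      IsGroupOneCoboundary (coadjointRep E G (Casimir π)) (groupCocycle hPoisson hm) := by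
  have hequiv (c : GroupLieAlgebra 𝓘(ℝ, E) G →ₗ[ℝ] Casimir π) :
      (m.addCasimir c).IsCoadjointEquivariant ↔
        ∀ g, groupCocycle hPoisson hm g = coadjointRep E G (Casimir π) g c - c := by
    rw [isCoadjointEquivariant_iff_groupCocycle_eq_zero hPoisson (hm.addCasimir c)]
    refine forall_congr' fun g ↦ ?_
    rw [groupCocycle_addCasimir hPoisson hm c
      (PreconnectedSpace.connectedComponent_eq_univ (1 : G) ▸ Set.mem_univ g)]
    exact sub_eq_zero (a := groupCocycle hPoisson hm g)
  constructor
  · rintro ⟨m', hm', heq⟩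
    exact ⟨momentumDifference hm' hm, (hequiv _).1 <| by
      rwa [addCasimir_momentumDifference hm' hm]⟩
  · rintro ⟨c, hc⟩
    exact ⟨m.addCasimir c, hm.addCasimir c, (hequiv c).2 hc⟩

end GroupCocycle

section TrivialCoefficients

variable {L : Type*} [LieRing L] [LieAlgebra ℝ L] {V : Type*} [AddCommGroup V] [Module ℝ V]

theorem lieH1Vanishes_trivial_iff :
    LieH1Vanishes L (TrivialLieModule ℝ L V) ↔
      ∀ f : L →ₗ[ℝ] V, (∀ x y : L, f ⁅x, y⁆ = 0) → f = 0 := by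
  let e := TrivialLieModule.equiv ℝ L V
  have hker (f : L →ₗ[ℝ] TrivialLieModule ℝ L V) :
      f ∈ LinearMap.ker (LieModule.Cohomology.d₁₂ ℝ L (TrivialLieModule ℝ L V)) ↔
        ∀ x y : L, f ⁅x, y⁆ = 0 := by
    refine ⟨fun hf x y ↦ ?_, fun hf ↦ DFunLike.ext _ _ fun x ↦ LinearMap.ext fun y ↦ ?_⟩
    · have hxy := DFunLike.congr_fun (DFunLike.congr_fun (LinearMap.mem_ker.1 hf) x) y
      rw [LieModule.Cohomology.d₁₂_apply_apply_ofTrivial] at hxy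
      exact neg_eq_zero.1 hxy
    · rw [LieModule.Cohomology.d₁₂_apply_apply_ofTrivial, hf, neg_zero]
      rfl
  have hrange (f : L →ₗ[ℝ] TrivialLieModule ℝ L V) :
      f ∈ LinearMap.range (lieD₀₁ L (TrivialLieModule ℝ L V)) ↔ f = 0 := by
    have hzero : lieD₀₁ L (TrivialLieModule ℝ L V) = 0 :=
      LinearMap.ext fun v ↦ LinearMap.ext fun x ↦ LieModule.IsTrivial.trivial x v
    rw [hzero, LinearMap.range_zero, Submodule.mem_bot]
  refine ⟨fun h f hf ↦ ?_, fun h f hf ↦ (hrange f).2 ?_⟩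
  · have hef := (hrange _).1 (h ((hker (e.symm.toLinearMap ∘ₗ f)).2 fun x y ↦ by simp [hf]))
    exact LinearMap.ext fun x ↦ e.symm.map_eq_zero_iff.1 (DFunLike.congr_fun hef x)
  · have hef := h (e.toLinearMap ∘ₗ f) fun x y ↦ by simp [(hker f).1 hf]
    exact LinearMap.ext fun x ↦ e.map_eq_zero_iff.1 (DFunLike.congr_fun hef x)

theorem lieH2Vanishes_trivial_iff :
    LieH2Vanishes L (TrivialLieModule ℝ L V) ↔
      ∀ θ : L →ₗ[ℝ] L →ₗ[ℝ] V, (∀ x, θ x x = 0) →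
        (∀ x y z : L, θ x ⁅y, z⁆ = θ ⁅x, y⁆ z + θ y ⁅x, z⁆) →
          ∃ f : L →ₗ[ℝ] V, ∀ x y : L, f ⁅x, y⁆ = θ x y := by
  let e := TrivialLieModule.equiv ℝ L V
  constructor
  · intro h θ hself hlie
    let a : LieModule.Cohomology.twoCochain ℝ L (TrivialLieModule ℝ L V) :=
      ⟨θ.compr₂ e.symm.toLinearMap, fun x ↦ by simp [hself]⟩
    obtain ⟨f, hf⟩ := h ((LieModule.Cohomology.mem_twoCocycle_iff_of_trivial ℝ L _ a).2
      fun x y z ↦ (congrArg e.symm (hlie x y z)).trans (map_add e.symm _ _))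
    refine ⟨-(e.toLinearMap ∘ₗ f), fun x y ↦ ?_⟩
    have hxy := DFunLike.congr_fun (DFunLike.congr_fun hf x) y
    rw [LieModule.Cohomology.d₁₂_apply_apply_ofTrivial] at hxy
    exact (map_neg e _).symm.trans (congrArg e hxy)
  · intro h a ha
    have hlie := (LieModule.Cohomology.mem_twoCocycle_iff_of_trivial ℝ L _ a).1 ha
    obtain ⟨f, hf⟩ := h (a.1.compr₂ e.toLinearMap)
      (fun x ↦ (congrArg e (a.2 x)).trans (map_zero e))
      fun x y z ↦ (congrArg e (hlie x y z)).trans (map_add e _ _)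
    refine ⟨-(e.symm.toLinearMap ∘ₗ f), DFunLike.ext _ _ fun x ↦ LinearMap.ext fun y ↦ ?_⟩
    rw [LieModule.Cohomology.d₁₂_apply_apply_ofTrivial]
    exact (neg_neg _).trans (congrArg e.symm (hf x y))

end TrivialCoefficients

section DualFactorization

variable {K M L V : Type*} [Field K] [AddCommGroup M] [Module K M] [AddCommGroup L] [Module K L]
  [AddCommGroup V] [Module K V]

theorem exists_comp_eq_of_ker_le_ker {T : M →ₗ[K] L} {Ω : M →ₗ[K] V}
    (h : LinearMap.ker T ≤ LinearMap.ker Ω) : ∃ f : L →ₗ[K] V, f ∘ₗ T = Ω := by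
  obtain ⟨f, hf⟩ :=
    ((LinearMap.ker T).liftQ Ω h ∘ₗ T.quotKerEquivRange.symm.toLinearMap).exists_extend
  refine ⟨f, LinearMap.ext fun x ↦ (DFunLike.congr_fun hf (T.rangeRestrict x)).trans ?_⟩
  rw [LinearMap.comp_apply, LinearEquiv.coe_coe]
  exact congrArg _ (T.quotKerEquivRange_symm_apply_image x (LinearMap.mem_range_self T x))

theorem exists_comp_eq_of_forall_dual {T : M →ₗ[K] L} {Ω : M →ₗ[K] V}
    (h : ∀ φ : Module.Dual K V, ∃ ψ : Module.Dual K L, ψ ∘ₗ T = φ ∘ₗ Ω) :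
    ∃ f : L →ₗ[K] V, f ∘ₗ T = Ω := by
  refine exists_comp_eq_of_ker_le_ker fun t ht ↦ ?_
  rw [LinearMap.mem_ker, ← Module.forall_dual_apply_eq_zero_iff K]
  intro φ
  obtain ⟨ψ, hψ⟩ := h φ
  rw [← LinearMap.comp_apply, ← hψ, LinearMap.comp_apply, LinearMap.mem_ker.1 ht, map_zero]

end DualFactorization

section Whitehead

variable {K L V : Type*} [Field K] [LieRing L] [LieAlgebra K L] [FiniteDimensional K L]
  [LieAlgebra.IsKilling K L] [AddCommGroup V] [Module K V]

open LieAlgebra.IsKilling in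
theorem linearMap_eq_zero_of_forall_lie {f : L →ₗ[K] V} (hf : ∀ x y : L, f ⁅x, y⁆ = 0) :
    f = 0 := by
  ext x
  rw [LinearMap.zero_apply, ← Module.forall_dual_apply_eq_zero_iff K]
  intro φ
  let κ := (killingForm K L).toDual (killingForm_nondegenerate K L)
  obtain ⟨z, hz⟩ := κ.surjective (φ ∘ₗ f)
  have hcentral : z ∈ LieAlgebra.center K L := by
    rw [LieModule.mem_maxTrivSubmodule]
    intro y
    refine κ.map_eq_zero_iff.1 (LinearMap.ext fun w ↦ ?_)
    calc killingForm K L ⁅y, z⁆ w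
      _ = killingForm K L z ⁅w, y⁆ := by
        rw [LieModule.traceForm_comm, ← LieModule.traceForm_apply_lie_apply,
          LieModule.traceForm_comm]
      _ = φ (f ⁅w, y⁆) := DFunLike.congr_fun hz _
      _ = 0 := by rw [hf, map_zero]
  rw [LieAlgebra.center_eq_bot, LieSubmodule.mem_bot] at hcentral
  rw [← LinearMap.comp_apply, ← hz, hcentral, map_zero, LinearMap.zero_apply]

-- The Killing form turns `θ` into a derivation of `L`, which is inner.
open LieAlgebra.IsKilling in
theorem exists_dual_lie_eq {θ : L →ₗ[K] L →ₗ[K] K}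
    (hlie : ∀ x y z : L, θ x ⁅y, z⁆ = θ ⁅x, y⁆ z + θ y ⁅x, z⁆) :
    ∃ φ : Module.Dual K L, ∀ x y : L, φ ⁅x, y⁆ = θ x y := by
  let κ := (killingForm K L).toDual (killingForm_nondegenerate K L)
  have hθ (x y : L) : killingForm K L (κ.symm (θ x)) y = θ x y :=
    LinearMap.BilinForm.apply_toDual_symm_apply (θ x) y
  let D : LieDerivation K L L :=
    { κ.symm.toLinearMap ∘ₗ θ with
      leibniz' := fun x y ↦ by
        refine κ.injective (LinearMap.ext fun z ↦ ?_)
        change killingForm K L (κ.symm (θ ⁅x, y⁆)) z =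
          killingForm K L (⁅x, κ.symm (θ y)⁆ - ⁅y, κ.symm (θ x)⁆) z
        rw [map_sub, LinearMap.sub_apply, LieModule.traceForm_apply_lie_apply',
          LieModule.traceForm_apply_lie_apply', hθ, hθ, hθ, hlie x y z]
        ring }
  obtain ⟨z, hz⟩ := LieDerivation.IsKilling.exists_eq_ad D
  refine ⟨killingForm K L z, fun x y ↦ ?_⟩
  have hzx : ⁅z, x⁆ = κ.symm (θ x) := by
    rw [← LieDerivation.ad_apply_apply (R := K), hz]
    rfl
  rw [← LieModule.traceForm_apply_lie_apply, hzx, hθ]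

theorem exists_linearMap_lie_eq {θ : L →ₗ[K] L →ₗ[K] V}
    (hlie : ∀ x y z : L, θ x ⁅y, z⁆ = θ ⁅x, y⁆ z + θ y ⁅x, z⁆) :
    ∃ f : L →ₗ[K] V, ∀ x y : L, f ⁅x, y⁆ = θ x y := by
  let lieBracket := TensorProduct.lift (LieModule.toEnd K L L : L →ₗ[K] Module.End K L)
  obtain ⟨f, hf⟩ := exists_comp_eq_of_forall_dual (T := lieBracket) (Ω := TensorProduct.lift θ)
    fun φ ↦ by
      obtain ⟨ψ, hψ⟩ := exists_dual_lie_eq (θ := θ.compr₂ φ)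
        fun x y z ↦ by simp only [LinearMap.compr₂_apply, hlie x y z, map_add]
      exact ⟨ψ, TensorProduct.ext' hψ⟩
  exact ⟨f, fun x y ↦ DFunLike.congr_fun hf (x ⊗ₜ[K] y)⟩

end Whitehead

section TrivialCoefficients

variable {L : Type*} [LieRing L] [LieAlgebra ℝ L] [FiniteDimensional ℝ L]
  [LieAlgebra.IsKilling ℝ L] {V : Type*} [AddCommGroup V] [Module ℝ V]

theorem lieH1Vanishes_trivial_of_isKilling : LieH1Vanishes L (TrivialLieModule ℝ L V) :=
  lieH1Vanishes_trivial_iff.2 fun _ ↦ linearMap_eq_zero_of_forall_lie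

theorem lieH2Vanishes_trivial_of_isKilling : LieH2Vanishes L (TrivialLieModule ℝ L V) :=
  lieH2Vanishes_trivial_iff.2 fun _ _ ↦ exists_linearMap_lie_eq

end TrivialCoefficients

section CohomologicalCriterion

variable {E : Type*} [NormedAddCommGroup E] [NormedSpace ℝ E] [CompleteSpace E]
  {F : Type*} [NormedAddCommGroup F] [NormedSpace ℝ F]
  {G : Type*} [TopologicalSpace G] [ChartedSpace E G] [Group G] [LieGroup 𝓘(ℝ, E) ∞ G]
  {P : Type*} [TopologicalSpace P] [ChartedSpace F P] [MulAction G P]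
  [ContMDiffSMul 𝓘(ℝ, E) 𝓘(ℝ, F) ∞ G P]
  {π : PoissonStructure F P} {m : SmoothMapToDual E F G P}

theorem lieCocycle_addCasimir (hm : IsMomentumMap π m)
    (c : GroupLieAlgebra 𝓘(ℝ, E) G →ₗ[ℝ] Casimir π) (X Y : GroupLieAlgebra 𝓘(ℝ, E) G) :
    lieCocycle (hm.addCasimir c) X Y = lieCocycle hm X Y + c ⁅X, Y⁆ := by
  apply Subtype.ext
  have hbracket : π.bracket (m.component X + (c X).1) (m.component Y + (c Y).1) =
      π.bracket (m.component X) (m.component Y) := by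
    rw [map_add, mem_casimir_iff_bracket_right.1 (c Y).2, add_zero, map_add, LinearMap.add_apply,
      (c X).2, add_zero]
  rw [Submodule.coe_add, lieCocycle_coe, lieCocycle_coe, m.component_addCasimir,
    m.component_addCasimir, m.component_addCasimir, hbracket]
  abel

theorem groupCocycle_lie (hPoisson : IsPoissonAction E G π) (hm : IsMomentumMap π m) (g : G)
    (X Y : GroupLieAlgebra 𝓘(ℝ, E) G) :
    (groupCocycle hPoisson hm g ⁅X, Y⁆).1 =
      translate E g (lieCocycle hm X Y).1 -
        (lieCocycle hm (Ad E g⁻¹ X) (Ad E g⁻¹ Y)).1 := by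
  have hbracket : translate E g (π.bracket (m.component X) (m.component Y)) =
      π.bracket (m.component (Ad E g⁻¹ X)) (m.component (Ad E g⁻¹ Y)) := by
    rw [← hPoisson, hm.bracket_translate hPoisson, ← π.neg_bracket, hm.bracket_translate hPoisson,
      π.neg_bracket]
  rw [lieCocycle_coe hm (Ad E g⁻¹ X), ← hbracket, ← Ad_lie]
  ext x
  exact (sub_sub_sub_cancel_right (m.component ⁅X, Y⁆ (g • x)) _ _).symm

theorem hasEquivariantMomentumMap_of_lieCohomology_eq_zero (hPoisson : IsPoissonAction E G π)
    (hm : IsMomentumMap π m)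
    (hH1 : LieH1Vanishes (GroupLieAlgebra 𝓘(ℝ, E) G) (TrivialCasimir E G π))
    (hH2 : LieH2Vanishes (GroupLieAlgebra 𝓘(ℝ, E) G) (TrivialCasimir E G π)) :
    HasEquivariantMomentumMap E G π := by
  obtain ⟨c, hc⟩ := lieH2Vanishes_trivial_iff.1 hH2 (lieCocycle hm) (lieCocycle_self hm)
    (lieCocycle_lie_right hm)
  have hm' : IsMomentumMap π (m.addCasimir (-c)) := hm.addCasimir (-c)
  have hΓ (X Y : GroupLieAlgebra 𝓘(ℝ, E) G) : lieCocycle hm' X Y = 0 := by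
    rw [lieCocycle_addCasimir hm, LinearMap.neg_apply, hc, add_neg_cancel]
  refine ⟨_, hm', (isCoadjointEquivariant_iff_groupCocycle_eq_zero hPoisson hm').2 fun g ↦ ?_⟩
  refine lieH1Vanishes_trivial_iff.1 hH1 _ fun X Y ↦ Subtype.ext ?_
  rw [groupCocycle_lie, hΓ, hΓ]
  exact sub_zero _

end CohomologicalCriterion

section SeparatingFamily

variable {K V ι : Type*} [Field K] [AddCommGroup V] [Module K V] {ev : ι → Module.Dual K V}

theorem span_range_eq_top_of_separating [FiniteDimensional K V]
    (hev : ∀ v, (∀ i, ev i v = 0) → v = 0) : Submodule.span K (Set.range ev) = ⊤ := by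
  have hbot : (Submodule.span K (Set.range ev)).dualCoannihilator = ⊥ :=
    (Submodule.eq_bot_iff _).2 fun v hv ↦ hev v fun i ↦
      (Submodule.mem_dualCoannihilator v).1 hv _ (Submodule.subset_span ⟨i, rfl⟩)
  rw [← Subspace.dualCoannihilator_dualAnnihilator_eq (W := Submodule.span K (Set.range ev)),
    hbot, Submodule.dualAnnihilator_bot]

theorem exists_mem_span_range_eqOn (hev : ∀ v, (∀ i, ev i v = 0) → v = 0) (U : Submodule K V)
    [FiniteDimensional K U] (ψ : Module.Dual K V) :
    ∃ φ ∈ Submodule.span K (Set.range ev), ∀ u ∈ U, φ u = ψ u := by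
  have htop := span_range_eq_top_of_separating (ev := fun i ↦ U.dualRestrict (ev i))
    fun u hu ↦ Subtype.ext (hev u.1 hu)
  rw [Set.range_comp' U.dualRestrict ev, ← Submodule.map_span, Submodule.eq_top_iff'] at htop
  obtain ⟨φ, hφ, hφψ⟩ := htop (U.dualRestrict ψ)
  exact ⟨φ, hφ, fun u hu ↦ DFunLike.congr_fun hφψ ⟨u, hu⟩⟩

theorem mem_of_forall_mem_span_range (hev : ∀ v, (∀ i, ev i v = 0) → v = 0) {W : Submodule K V}
    [FiniteDimensional K W] {v : V}
    (hv : ∀ φ ∈ Submodule.span K (Set.range ev), (∀ w ∈ W, φ w = 0) → φ v = 0) : v ∈ W := by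
  by_contra hvW
  obtain ⟨ψ, hψv, hψW⟩ := Submodule.exists_le_ker_of_notMem hvW
  obtain ⟨φ, hφ, hφψ⟩ := exists_mem_span_range_eqOn hev (W ⊔ K ∙ v) ψ
  refine hψv ?_
  rw [← hφψ v (Submodule.mem_sup_right (Submodule.mem_span_singleton_self v))]
  exact hv φ hφ fun w hw ↦ (hφψ w (Submodule.mem_sup_left hw)).trans (hψW hw)

end SeparatingFamily

section Mean

open MeasureTheory

variable {V ι α : Type*} [AddCommGroup V] [Module ℝ V] {ev : ι → Module.Dual ℝ V}
  [MeasurableSpace α] {μ : Measure α}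

theorem exists_forall_apply_eq_integral [FiniteDimensional ℝ V]
    (hev : ∀ v, (∀ i, ev i v = 0) → v = 0) {h : α → V}
    (hh : ∀ i, Integrable (fun a ↦ ev i (h a)) μ) : ∃ w, ∀ i, ev i w = ∫ a, ev i (h a) ∂μ := by
  have hint (φ : Module.Dual ℝ V) : Integrable (fun a ↦ φ (h a)) μ := by
    have hφ : φ ∈ Submodule.span ℝ (Set.range ev) :=
      span_range_eq_top_of_separating hev ▸ Submodule.mem_top
    induction hφ using Submodule.span_induction with
    | mem φ hφ =>
      obtain ⟨i, rfl⟩ := hφ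
      exact hh i
    | zero => exact integrable_zero _ _ _
    | add φ ψ _ _ hφ hψ => exact hφ.add hψ
    | smul t φ _ hφ => exact hφ.const_mul t
  let mean : Module.Dual ℝ (Module.Dual ℝ V) :=
    { toFun := fun φ ↦ ∫ a, φ (h a) ∂μ
      map_add' := fun φ ψ ↦ integral_add (hint φ) (hint ψ)
      map_smul' := fun t φ ↦ integral_const_mul t _ }
  exact ⟨(Module.evalEquiv ℝ V).symm mean, fun i ↦
    Module.apply_evalEquiv_symm_apply ℝ V (ev i) mean⟩

theorem exists_linearMap_apply_eq_integral {L : Type*} [AddCommGroup L] [Module ℝ L]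
    [FiniteDimensional ℝ L] (hev : ∀ v, (∀ i, ev i v = 0) → v = 0) {W : Submodule ℝ V}
    [FiniteDimensional ℝ W] {h : α → L →ₗ[ℝ] V} (hW : ∀ a y, h a y ∈ W)
    (hh : ∀ i y, Integrable (fun a ↦ ev i (h a y)) μ) :
    ∃ c : L →ₗ[ℝ] V, ∀ i y, ev i (c y) = ∫ a, ev i (h a y) ∂μ := by
  let evW (p : ι × L) : Module.Dual ℝ (L →ₗ[ℝ] W) :=
    ev p.1 ∘ₗ W.subtype ∘ₗ LinearMap.applyₗ p.2
  obtain ⟨c, hc⟩ := exists_forall_apply_eq_integral (ev := evW) (μ := μ)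
    (h := fun a ↦ (h a).codRestrict W (hW a))
    (fun c hc ↦ LinearMap.ext fun y ↦ Subtype.ext (hev _ fun i ↦ hc (i, y)))
    fun p ↦ hh p.1 p.2
  exact ⟨W.subtype ∘ₗ c, fun i y ↦ hc (i, y)⟩

end Mean

section FiniteDimensionalRange

variable {E : Type*} [NormedAddCommGroup E] [NormedSpace ℝ E] [FiniteDimensional ℝ E]
  [CompleteSpace E]
  {F : Type*} [NormedAddCommGroup F] [NormedSpace ℝ F]
  {G : Type*} [TopologicalSpace G] [ChartedSpace E G] [Group G] [LieGroup 𝓘(ℝ, E) ∞ G]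
  {P : Type*} [TopologicalSpace P] [ChartedSpace F P] [MulAction G P]
  [ContMDiffSMul 𝓘(ℝ, E) 𝓘(ℝ, F) ∞ G P]
  {π : PoissonStructure F P} {m : SmoothMapToDual E F G P}

instance instFiniteDimensionalGroupLieAlgebra :
    FiniteDimensional ℝ (GroupLieAlgebra 𝓘(ℝ, E) G) :=
  inferInstanceAs (FiniteDimensional ℝ E)

/-- Evaluation of Casimir functions at the point `x`. -/
def casimirEval (π : PoissonStructure F P) (x : P) : Module.Dual ℝ (Casimir π) where
  toFun c := c.1 x
  map_add' _ _ := rfl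
  map_smul' _ _ := rfl

theorem eq_zero_of_forall_casimirEval_eq_zero (c : Casimir π)
    (hc : ∀ x, casimirEval π x c = 0) : c = 0 := by
  ext x
  exact hc x

omit [FiniteDimensional ℝ E] [CompleteSpace E] in
theorem groupCocycle_one (hPoisson : IsPoissonAction E G π) (hm : IsMomentumMap π m) :
    groupCocycle hPoisson hm 1 = 0 := by
  have hmul := groupCocycle_mul hPoisson hm 1 (mem_connectedComponent (x := (1 : G)))
  rw [mul_one, map_one] at hmul
  ext Y x
  exact left_eq_add.1 (congrArg (fun ψ ↦ (ψ Y).1 x) hmul)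

theorem hasMFDerivAt_groupCocycle (hPoisson : IsPoissonAction E G π) (hm : IsMomentumMap π m)
    {φ : Module.Dual ℝ (Casimir π)} (hφ : φ ∈ Submodule.span ℝ (Set.range (casimirEval π)))
    (Y : GroupLieAlgebra 𝓘(ℝ, E) G) :
    HasMFDerivAt 𝓘(ℝ, E) 𝓘(ℝ, ℝ) (fun g : G ↦ φ (groupCocycle hPoisson hm g Y)) 1
      (show E →L[ℝ] ℝ from LinearMap.toContinuousLinearMap
        (show E →ₗ[ℝ] ℝ from φ ∘ₗ (lieCocycle hm).flip Y)) := by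
  induction hφ using Submodule.span_induction with
  | mem φ hφ =>
    obtain ⟨x, rfl⟩ := hφ
    exact (mdifferentiableAt_defect m x Y).hasMFDerivAt.congr_mfderiv <|
      ContinuousLinearMap.ext fun X ↦ mfderiv_defect hm X Y x
  | zero => exact hasMFDerivAt_const (0 : ℝ) 1
  | add φ ψ _ _ hφ hψ => exact hφ.add hψ
  | smul t φ _ hφ => exact hφ.const_smul t

theorem finiteDimensional_map₂_lieCocycle (hm : IsMomentumMap π m) :
    FiniteDimensional ℝ (Submodule.map₂ (lieCocycle hm) ⊤ ⊤) :=
  Module.Finite.iff_fg.2 (Module.Finite.fg_top.map₂ _ Module.Finite.fg_top)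

theorem groupCocycle_mem_map₂_lieCocycle (hPoisson : IsPoissonAction E G π)
    (hm : IsMomentumMap π m) {g : G} (hg : g ∈ connectedComponent (1 : G))
    (Y : GroupLieAlgebra 𝓘(ℝ, E) G) :
    groupCocycle hPoisson hm g Y ∈ Submodule.map₂ (lieCocycle hm) ⊤ ⊤ := by
  have := finiteDimensional_map₂_lieCocycle hm
  refine mem_of_forall_mem_span_range eq_zero_of_forall_casimirEval_eq_zero fun φ hφ hφΓ ↦ ?_
  have hconst : φ (groupCocycle hPoisson hm g Y) = φ (groupCocycle hPoisson hm 1 Y) := by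
    refine eq_apply_one_of_hasMFDerivAt_mul_left_zero (E := E)
      (f := fun k ↦ φ (groupCocycle hPoisson hm k Y)) (fun k _ ↦ ?_) hg
    have : LocallyConnectedSpace G := ChartedSpace.locallyConnectedSpace E G
    have hmul : (fun j ↦ φ (groupCocycle hPoisson hm (k * j) Y)) =ᶠ[𝓝 1] fun j ↦
        φ (groupCocycle hPoisson hm k Y) + φ (groupCocycle hPoisson hm j (Ad E k⁻¹ Y)) := by
      filter_upwards [isOpen_connectedComponent.mem_nhds mem_connectedComponent] with j hj
      rw [groupCocycle_mul hPoisson hm k hj, ← map_add]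
      rfl
    have hderiv := (hasMFDerivAt_const (φ (groupCocycle hPoisson hm k Y)) (1 : G)).add
      (hasMFDerivAt_groupCocycle hPoisson hm hφ (Ad E k⁻¹ Y))
    refine (hderiv.congr_of_eventuallyEq hmul).congr_mfderiv ?_
    ext X
    exact (zero_add _).trans <| hφΓ _ <| Submodule.apply_mem_map₂ _ trivial trivial
  rw [hconst, groupCocycle_one]
  exact map_zero φ

end FiniteDimensionalRange

section Averaging

open MeasureTheory

variable {E : Type*} [NormedAddCommGroup E] [NormedSpace ℝ E]
  {F : Type*} [NormedAddCommGroup F] [NormedSpace ℝ F]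
  {G : Type*} [TopologicalSpace G] [ChartedSpace E G] [Group G] [LieGroup 𝓘(ℝ, E) ∞ G]
  {P : Type*} [TopologicalSpace P] [ChartedSpace F P] [MulAction G P]
  {π : PoissonStructure F P} {m : SmoothMapToDual E F G P}

theorem Ad_Ad_inv (g : G) (Y : GroupLieAlgebra 𝓘(ℝ, E) G) : Ad E g (Ad E g⁻¹ Y) = Y := by
  rw [← LinearMap.comp_apply, ← Ad_mul, mul_inv_cancel, Ad_one, LinearMap.id_apply]

theorem SmoothMapToDual.defect_inv_Ad_inv (m : SmoothMapToDual E F G P) (g : G) (x : P)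
    (Y : GroupLieAlgebra 𝓘(ℝ, E) G) :
    m.defect g⁻¹ x (Ad E g⁻¹ Y) = m.toFun (g⁻¹ • x) (Ad E g⁻¹ Y) - m.toFun x Y := by
  rw [defect, LinearMap.sub_apply, LinearMap.comp_apply, inv_inv, Ad_Ad_inv]

theorem SmoothMapToDual.continuous_inv_smul_Ad_inv [FiniteDimensional ℝ E]
    [ContMDiffSMul 𝓘(ℝ, E) 𝓘(ℝ, F) ∞ G P] (m : SmoothMapToDual E F G P) (x : P)
    (Y : GroupLieAlgebra 𝓘(ℝ, E) G) :
    Continuous fun g : G ↦ m.toFun (g⁻¹ • x) (Ad E g⁻¹ Y) := by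
  have : IsTopologicalGroup G := topologicalGroup_of_lieGroup 𝓘(ℝ, E) ∞
  let ξ (g : G) : E →L[ℝ] ℝ :=
    LinearMap.toContinuousLinearMap (show E →ₗ[ℝ] ℝ from m.toFun (g⁻¹ • x))
  have hξ : Continuous ξ := continuous_clm_apply.2 fun v ↦
    (contMDiff_orbit (E := E) (m.component v) x).continuous.comp continuous_inv
  exact hξ.clm_apply (continuous_adInv (E := E) Y)

theorem SmoothMapToDual.isCoadjointEquivariant_of_eq_integral [MeasurableSpace G]
    [MeasurableMul G] {μ : Measure G} [μ.IsMulLeftInvariant] {M : SmoothMapToDual E F G P}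
    (hM : ∀ x Y, M.toFun x Y = ∫ g : G, m.toFun (g⁻¹ • x) (Ad E g⁻¹ Y) ∂μ) :
    M.IsCoadjointEquivariant := by
  intro k x
  ext Y
  calc M.toFun (k • x) Y
    _ = ∫ g : G, m.toFun ((k⁻¹ * g)⁻¹ • x) (Ad E (k⁻¹ * g)⁻¹ (Ad E k⁻¹ Y)) ∂μ := by
      simp only [hM, mul_inv_rev, inv_inv, mul_smul, Ad_mul, LinearMap.comp_apply, Ad_Ad_inv]
    _ = M.toFun x (Ad E k⁻¹ Y) := by
      rw [hM, integral_mul_left_eq_self fun g : G ↦ m.toFun (g⁻¹ • x) (Ad E g⁻¹ (Ad E k⁻¹ Y))]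

variable [FiniteDimensional ℝ E] [CompleteSpace E] [ContMDiffSMul 𝓘(ℝ, E) 𝓘(ℝ, F) ∞ G P]
  [CompactSpace G]

theorem exists_finiteDimensional_groupCocycle_mem (hPoisson : IsPoissonAction E G π)
    (hm : IsMomentumMap π m) :
    ∃ W : Submodule ℝ (Casimir π), FiniteDimensional ℝ W ∧
      ∀ (g : G) (Y : GroupLieAlgebra 𝓘(ℝ, E) G), groupCocycle hPoisson hm g Y ∈ W := by
  have : IsTopologicalGroup G := topologicalGroup_of_lieGroup 𝓘(ℝ, E) ∞
  have : LocallyConnectedSpace G := ChartedSpace.locallyConnectedSpace E G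
  let N := Subgroup.connectedComponentOfOne G
  have : Finite (G ⧸ N) := N.quotient_finite_of_isOpen isOpen_connectedComponent
  let Wcoset : Submodule ℝ (Casimir π) :=
    ⨆ q : G ⧸ N, LinearMap.range (groupCocycle hPoisson hm q.out)
  have := finiteDimensional_map₂_lieCocycle hm
  refine ⟨Submodule.map₂ (lieCocycle hm) ⊤ ⊤ ⊔ Wcoset, inferInstance, fun g Y ↦ ?_⟩
  obtain ⟨h, hh⟩ := QuotientGroup.mk_out_eq_mul N g
  have hhinv : (h : G)⁻¹ ∈ connectedComponent (1 : G) := N.inv_mem h.2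
  rw [← mul_inv_cancel_right g (h : G), ← hh, groupCocycle_mul hPoisson hm _ hhinv]
  exact add_mem
    (Submodule.mem_sup_right (Submodule.mem_iSup_of_mem (QuotientGroup.mk g) ⟨Y, rfl⟩))
    (Submodule.mem_sup_left (groupCocycle_mem_map₂_lieCocycle hPoisson hm hhinv _))

theorem hasEquivariantMomentumMap_of_compactSpace (hPoisson : IsPoissonAction E G π)
    (hm : IsMomentumMap π m) : HasEquivariantMomentumMap E G π := by
  have : IsTopologicalGroup G := topologicalGroup_of_lieGroup 𝓘(ℝ, E) ∞
  borelize G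
  let μ : Measure G := Measure.haarMeasure ⊤
  have : IsProbabilityMeasure μ := ⟨Measure.haarMeasure_self⟩
  obtain ⟨W, hWfin, hW⟩ := exists_finiteDimensional_groupCocycle_mem hPoisson hm
  have hint (x : P) (Y : GroupLieAlgebra 𝓘(ℝ, E) G) :
      Integrable (fun g : G ↦ m.toFun (g⁻¹ • x) (Ad E g⁻¹ Y)) μ :=
    (m.continuous_inv_smul_Ad_inv x Y).integrable_of_hasCompactSupport
      (HasCompactSupport.of_compactSpace _)
  have heval (x : P) (Y : GroupLieAlgebra 𝓘(ℝ, E) G) :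
      (fun g : G ↦ casimirEval π x (groupCocycle hPoisson hm g⁻¹ (Ad E g⁻¹ Y))) =
        fun g ↦ m.toFun (g⁻¹ • x) (Ad E g⁻¹ Y) - m.toFun x Y :=
    funext fun g ↦ m.defect_inv_Ad_inv g x Y
  obtain ⟨c, hc⟩ := exists_linearMap_apply_eq_integral (μ := μ) (ev := casimirEval π)
    (h := fun g ↦ groupCocycle hPoisson hm g⁻¹ ∘ₗ Ad E g⁻¹)
    eq_zero_of_forall_casimirEval_eq_zero (fun g Y ↦ hW g⁻¹ _)
    (fun x Y ↦ (heval x Y).symm ▸ (hint x Y).sub (integrable_const (m.toFun x Y)))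
  refine ⟨m.addCasimir c, hm.addCasimir c,
    SmoothMapToDual.isCoadjointEquivariant_of_eq_integral (μ := μ) (m := m) fun x Y ↦ ?_⟩
  calc m.toFun x Y + casimirEval π x (c Y)
    _ = m.toFun x Y + ∫ g : G, (m.toFun (g⁻¹ • x) (Ad E g⁻¹ Y) - m.toFun x Y) ∂μ := by
      rw [← heval, hc]
      rfl
    _ = ∫ g : G, m.toFun (g⁻¹ • x) (Ad E g⁻¹ Y) ∂μ := by
      rw [integral_sub (hint x Y) (integrable_const _), integral_const, probReal_univ, one_smul,
        add_sub_cancel]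

end Averaging

end TangentialPoisson

end

theorem mainTheorem3_general
    {E : Type*} [NormedAddCommGroup E] [NormedSpace ℝ E] [FiniteDimensional ℝ E] [CompleteSpace E]
    {F : Type*} [NormedAddCommGroup F] [NormedSpace ℝ F]
    {G : Type*} [TopologicalSpace G] [ChartedSpace E G] [Group G] [LieGroup 𝓘(ℝ, E) ∞ G]
    {P : Type*} [TopologicalSpace P] [ChartedSpace F P]
    [MulAction G P] [ContMDiffSMul 𝓘(ℝ, E) 𝓘(ℝ, F) ∞ G P]
    (π : PoissonStructure F P)
    (hPoisson : IsPoissonAction E G π) (m : SmoothMapToDual E F G P) (hm : IsMomentumMap π m) :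
    (∃ Γ ∈ LieModule.Cohomology.twoCocycle ℝ (GroupLieAlgebra 𝓘(ℝ, E) G) (TrivialCasimir E G π),
      ∀ (X Y : GroupLieAlgebra 𝓘(ℝ, E) G) (x : P),
        (TrivialLieModule.equiv ℝ (GroupLieAlgebra 𝓘(ℝ, E) G) (Casimir π) (Γ X Y)).1 x =
          m.component ⁅X, Y⁆ x - π.bracket (m.component X) (m.component Y) x ∧
        (TrivialLieModule.equiv ℝ (GroupLieAlgebra 𝓘(ℝ, E) G) (Casimir π) (Γ X Y)).1 x =
          mfderiv 𝓘(ℝ, E) 𝓘(ℝ, ℝ) (fun g : G ↦ m.defect g x Y) 1 X) ∧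
    (ConnectedSpace G →
      ∃ Ψ : G → GroupLieAlgebra 𝓘(ℝ, E) G →ₗ[ℝ] Casimir π,
        (∀ (g : G) (Y : GroupLieAlgebra 𝓘(ℝ, E) G) (x : P), (Ψ g Y).1 x = m.defect g x Y) ∧
        IsGroupOneCocycle (coadjointRep E G (Casimir π)) Ψ ∧
        (HasEquivariantMomentumMap E G π ↔
          IsGroupOneCoboundary (coadjointRep E G (Casimir π)) Ψ)) ∧
    (CompactSpace G → HasEquivariantMomentumMap E G π) ∧
    (LieH1Vanishes (GroupLieAlgebra 𝓘(ℝ, E) G) (TrivialCasimir E G π) →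
      LieH2Vanishes (GroupLieAlgebra 𝓘(ℝ, E) G) (TrivialCasimir E G π) →
      HasEquivariantMomentumMap E G π) ∧
    (LieAlgebra.IsSemisimple ℝ (GroupLieAlgebra 𝓘(ℝ, E) G) →
      LieH1Vanishes (GroupLieAlgebra 𝓘(ℝ, E) G) (TrivialCasimir E G π) ∧
      LieH2Vanishes (GroupLieAlgebra 𝓘(ℝ, E) G) (TrivialCasimir E G π) ∧
      HasEquivariantMomentumMap E G π) := by
  refine ⟨⟨lieTwoCochain hm, lieTwoCochain_mem_twoCocycle hm, fun X Y x ↦ ?_⟩, fun _ ↦ ?_,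
    fun _ ↦ hasEquivariantMomentumMap_of_compactSpace hPoisson hm,
    hasEquivariantMomentumMap_of_lieCohomology_eq_zero hPoisson hm, fun _ ↦ ?_⟩
  · rw [lieTwoCochain_apply, LinearEquiv.apply_symm_apply]
    exact ⟨rfl, (mfderiv_defect hm X Y x).symm⟩
  · exact ⟨groupCocycle hPoisson hm, groupCocycle_coe_apply hPoisson hm,
      isGroupOneCocycle_groupCocycle hPoisson hm,
      hasEquivariantMomentumMap_iff_isGroupOneCoboundary hPoisson hm⟩
  · have hH1 : LieH1Vanishes (GroupLieAlgebra 𝓘(ℝ, E) G) (TrivialCasimir E G π) :=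
      lieH1Vanishes_trivial_of_isKilling
    have hH2 : LieH2Vanishes (GroupLieAlgebra 𝓘(ℝ, E) G) (TrivialCasimir E G π) :=
      lieH2Vanishes_trivial_of_isKilling
    exact ⟨hH1, hH2, hasEquivariantMomentumMap_of_lieCohomology_eq_zero hPoisson hm hH1 hH2⟩

theorem mainTheorem3
    {E : Type*} [NormedAddCommGroup E] [NormedSpace ℝ E] [FiniteDimensional ℝ E] [CompleteSpace E]
    {F : Type*} [NormedAddCommGroup F] [NormedSpace ℝ F] [FiniteDimensional ℝ F]
    {G : Type*} [TopologicalSpace G] [ChartedSpace E G] [Group G] [LieGroup 𝓘(ℝ, E) ∞ G]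
    {P : Type*} [TopologicalSpace P] [ChartedSpace F P] [IsManifold 𝓘(ℝ, F) ∞ P] [T2Space P]
    [MulAction G P] [ContMDiffSMul 𝓘(ℝ, E) 𝓘(ℝ, F) ∞ G P]
    (π : PoissonStructure F P)
    (hPoisson : IsPoissonAction E G π) (hTangential : IsTangential E G π)
    (m : SmoothMapToDual E F G P) (hm : IsMomentumMap π m) :
    -- `Γ` is a 2-cocycle of `𝔤` with values in the trivial module `Car(P)`
    (∃ Γ ∈ LieModule.Cohomology.twoCocycle ℝ (GroupLieAlgebra 𝓘(ℝ, E) G) (TrivialCasimir E G π),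
      ∀ (X Y : GroupLieAlgebra 𝓘(ℝ, E) G) (x : P),
        (TrivialLieModule.equiv ℝ (GroupLieAlgebra 𝓘(ℝ, E) G) (Casimir π) (Γ X Y)).1 x =
          m.component ⁅X, Y⁆ x - π.bracket (m.component X) (m.component Y) x ∧
        (TrivialLieModule.equiv ℝ (GroupLieAlgebra 𝓘(ℝ, E) G) (Casimir π) (Γ X Y)).1 x =
          mfderiv 𝓘(ℝ, E) 𝓘(ℝ, ℝ) (fun g : G ↦ m.defect g x Y) 1 X) ∧
    -- `Ψ` is a 1-cocycle of `G`, and it is the obstruction to equivariance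
    (ConnectedSpace G →
      ∃ Ψ : G → GroupLieAlgebra 𝓘(ℝ, E) G →ₗ[ℝ] Casimir π,
        (∀ (g : G) (Y : GroupLieAlgebra 𝓘(ℝ, E) G) (x : P), (Ψ g Y).1 x = m.defect g x Y) ∧
        IsGroupOneCocycle (coadjointRep E G (Casimir π)) Ψ ∧
        (HasEquivariantMomentumMap E G π ↔
          IsGroupOneCoboundary (coadjointRep E G (Casimir π)) Ψ)) ∧
    (CompactSpace G → HasEquivariantMomentumMap E G π) ∧
    (LieH1Vanishes (GroupLieAlgebra 𝓘(ℝ, E) G) (TrivialCasimir E G π) →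
      LieH2Vanishes (GroupLieAlgebra 𝓘(ℝ, E) G) (TrivialCasimir E G π) →
      HasEquivariantMomentumMap E G π) ∧
    (LieAlgebra.IsSemisimple ℝ (GroupLieAlgebra 𝓘(ℝ, E) G) →
      LieH1Vanishes (GroupLieAlgebra 𝓘(ℝ, E) G) (TrivialCasimir E G π) ∧
      LieH2Vanishes (GroupLieAlgebra 𝓘(ℝ, E) G) (TrivialCasimir E G π) ∧
      HasEquivariantMomentumMap E G π) :=
  mainTheorem3_general π hPoisson m hm
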